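/- Let $R$ be an associative ring with identity. Call $R$ quasi-Frobenius if it is left and right artinian and left and right self-injective (that is, injective as a left and as a right module over itself). Call $R$ left $2$-injective if, for every left ideal $I$ of $R$ generated by two (not necessarily distinct) elements, every left $R$-module homomorphism $I\to R$ extends to a left $R$-module homomorphism $R\to R$. A left ideal $C$ of $R$ is a complement left ideal if there is a left ideal $S$ of $R$ such that $C$ is maximal among the left ideals $C'$ with $C'\cap S=0$. A left ideal $I$ of $R$ is small if, for every left ideal $K$ of $R$, $K+I=R$ implies $K=R$. Theorem. $R$ is quasi-Frobenius if and only if $R$ is right noetherian, $R$ is left $2$-injective, and no nonzero complement left ideal of $R$ is small. -/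

import Mathlib

/-- A ring `R` is right noetherian: `R`, as a right module over itself (that is, as a left module
over `Rᵐᵒᵖ` through `op r • x = x * r`), is noetherian. -/
def IsRightNoetherianRing (R : Type*) [Ring R] : Prop :=
  IsNoetherian Rᵐᵒᵖ R

/-- A ring is quasi-Frobenius if it is artinian on both sides and self-injective on both sides. -/
structure IsQuasiFrobenius (R : Type*) [Ring R] : Prop where
  left_artinian : IsArtinian R R
  right_artinian : IsArtinian Rᵐᵒᵖ R
  left_injective : Module.Injective R R
  right_injective : Module.Injective Rᵐᵒᵖ R

/-- A ring `R` is left `n`-injective if every left `R`-linear map from a left ideal generated by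
`n` (not necessarily distinct) elements to `R` extends to a left `R`-linear map `R → R`. -/
def IsLeftNInjective (n : ℕ) (R : Type*) [Ring R] : Prop :=
  ∀ I : Ideal R, (∃ a : Fin n → R, I = Ideal.span (Set.range a)) →
    ∀ f : I →ₗ[R] R, ∃ g : R →ₗ[R] R, ∀ x : I, g x = f x

/-- `C` is a complement to `S` in `M`: it is maximal among the submodules that meet `S` in `0`. -/
def IsComplementTo {R M : Type*} [Ring R] [AddCommGroup M] [Module R M]
    (C S : Submodule R M) : Prop :=
  Maximal (fun N : Submodule R M => N ⊓ S = ⊥) C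

/-- `C` is a complement in `M`: it is a complement to some submodule of `M`. -/
def IsComplementSubmodule {R M : Type*} [Ring R] [AddCommGroup M] [Module R M]
    (C : Submodule R M) : Prop :=
  ∃ S : Submodule R M, IsComplementTo C S

/-- A left ideal `I` is small if `K + I = R` implies `K = R` for every left ideal `K`. -/
def IsSmallLeftIdeal {R : Type*} [Ring R] (I : Ideal R) : Prop :=
  ∀ K : Ideal R, K ⊔ I = ⊤ → K = ⊤

/-! For the harder direction, 2-injectivity enters only through `LeftPInjective`, by which a
containment of left annihilators of elements reverses to one of the right ideals they generate, and
`SeparatesIndependent`. The ascending chain condition on right annihilators then gives a uniform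
left ideal inside every nonzero `Ra`. It enlarges to a uniform complement, which is not small and so
contains an element whose left annihilator is not essential; this forces the complement to be `Rg`
with `g` idempotent (`IsUniformIdeal.exists_idempotent`). By right noetherianity, finitely many such
`g` generate `R`.

Each `Rg` is local, so `R/J` is semisimple for `J` the Jacobson radical. The left annihilator of `J`
is essential as a left ideal, and right noetherianity makes `J` nilpotent. Each `Rg` contains a
simple left ideal whose type determines the top of `Rg`; since there are finitely many types, every
simple left module embeds in `R` (`LeftKasch`). Hence the part of `Rg` that `J` kills from the right
is simple or zero, and filtering by powers of `J` makes `R` left noetherian, then left artinian by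
Hopkins–Levitzki.

Along a covering relation of one-sided ideals the length of the annihilator drops by at most one.
Summing on both sides, the left and right lengths of `R` are finite and equal, so every drop is
exactly one. Annihilators therefore separate covering pairs, and a map from a one-sided ideal
extends one simple factor at a time.

Conversely, over a quasi-Frobenius ring a complement left ideal is `Re` with `e` idempotent
(`IsComplementTo.exists_idempotent`); it is not small when nonzero, because `R(1-e)` supplements it.
-/

/-- Elements annihilated by `S` from the left. -/
def rightAnn {R : Type*} [Ring R] (S : Set R) : Submodule Rᵐᵒᵖ R where
  carrier := {y | ∀ x ∈ S, x * y = 0}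
  add_mem' ha hb x hx := by rw [mul_add, ha x hx, hb x hx, add_zero]
  zero_mem' x _ := mul_zero x
  smul_mem' c y hy x hx := by
    rw [MulOpposite.smul_eq_mul_unop, ← mul_assoc, hy x hx, zero_mul]

/-- Elements annihilated by `S` from the right. -/
def leftAnn {R : Type*} [Ring R] (S : Set R) : Ideal R where
  carrier := {x | ∀ y ∈ S, x * y = 0}
  add_mem' ha hb x hx := by rw [add_mul, ha x hx, hb x hx, add_zero]
  zero_mem' x _ := zero_mul x
  smul_mem' c y hy x hx := by rw [smul_eq_mul, mul_assoc, hy x hx, mul_zero]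

theorem mem_rightAnn {R : Type*} [Ring R] {S : Set R} {y : R} :
    y ∈ rightAnn S ↔ ∀ x ∈ S, x * y = 0 := Iff.rfl

theorem mem_leftAnn {R : Type*} [Ring R] {S : Set R} {x : R} :
    x ∈ leftAnn S ↔ ∀ y ∈ S, x * y = 0 := Iff.rfl

theorem mem_rightAnn_singleton {R : Type*} [Ring R] {x y : R} :
    y ∈ rightAnn {x} ↔ x * y = 0 := by simp [mem_rightAnn]

/-- The principal right ideal generated by `a`. -/
def rightSpan {R : Type*} [Ring R] (a : R) : Submodule Rᵐᵒᵖ R := Submodule.span Rᵐᵒᵖ {a}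

theorem mem_rightSpan {R : Type*} [Ring R] {a x : R} : x ∈ rightSpan a ↔ ∃ r, x = a * r := by
  rw [rightSpan, Submodule.mem_span_singleton]
  exact ⟨fun ⟨r, h⟩ => ⟨r.unop, by rw [← h, MulOpposite.smul_eq_mul_unop]⟩,
    fun ⟨r, h⟩ => ⟨MulOpposite.op r, by rw [h, op_smul_eq_mul]⟩⟩

/-- Left principal injectivity in terms of annihilators. -/
def LeftPInjective (R : Type*) [Ring R] : Prop :=
  ∀ a b : R, (∀ r, r * a = 0 → r * b = 0) → ∃ u, b = a * u

/-- Independent principal left ideals have comaximal right annihilators. -/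
def SeparatesIndependent (R : Type*) [Ring R] : Prop :=
  ∀ a b : R, (∀ x y, x * a = y * b → x * a = 0) → ∃ c, a * c = a ∧ b * c = 0

/-- Nonzero uniform left ideals. -/
def IsUniformIdeal {R : Type*} [Ring R] (I : Ideal R) : Prop :=
  I ≠ ⊥ ∧ ∀ a ∈ I, ∀ b ∈ I, a ≠ 0 → b ≠ 0 → ∃ x y, x * a = y * b ∧ x * a ≠ 0

/-! ### Annihilator conditions from 2-injectivity -/

theorem exists_extension_of_two {R : Type*} [Ring R] (h : IsLeftNInjective 2 R) (a b : R)
    (f : Ideal.span {a, b} →ₗ[R] R) : ∃ u, ∀ x : Ideal.span {a, b}, f x = x * u := by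
  obtain ⟨g, hg⟩ := h (Ideal.span {a, b}) ⟨![a, b], by simp [Matrix.range_cons, Matrix.range_empty, Set.pair_comm]⟩ f
  refine ⟨g 1, fun x => ?_⟩
  rw [← hg x, ← smul_eq_mul, ← map_smul, smul_eq_mul, mul_one]

theorem exists_mul_of_two {R : Type*} [Ring R] (h : IsLeftNInjective 2 R) (a b c d : R)
    (H : ∀ x y, x * a + y * b = 0 → x * c + y * d = 0) : ∃ u, a * u = c ∧ b * u = d := by
  have key : ∀ z : Ideal.span {a, b}, ∃ x y, x * a + y * b = z := fun z =>
    Ideal.mem_span_pair.1 z.2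
  choose p q hpq using key
  have val : ∀ (z : Ideal.span {a, b}) (x y : R), x * a + y * b = z →
      p z * c + q z * d = x * c + y * d := by
    intro z x y hz
    have := H (p z - x) (q z - y) (by
      have h1 := hpq z
      rw [← hz] at h1
      rw [sub_mul, sub_mul, ← sub_eq_zero.2 h1]
      abel)
    rw [sub_mul, sub_mul] at this
    rw [← sub_eq_zero, ← this]; abel
  let f : Ideal.span {a, b} →ₗ[R] R :=
    { toFun := fun z => p z * c + q z * d
      map_add' := fun z w => by
        rw [val (z + w) (p z + p w) (q z + q w) (by
          rw [Submodule.coe_add, ← hpq z, ← hpq w]; noncomm_ring)]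
        noncomm_ring
      map_smul' := fun r z => by
        rw [val (r • z) (r * p z) (r * q z) (by
          rw [Submodule.coe_smul, ← hpq z, smul_eq_mul]; noncomm_ring)]
        simp only [RingHom.id_apply, smul_eq_mul]; noncomm_ring }
  obtain ⟨u, hu⟩ := exists_extension_of_two h a b f
  refine ⟨u, ?_, ?_⟩
  · have := hu ⟨a, Ideal.subset_span (by simp)⟩
    rw [← this]
    exact (val _ 1 0 (by simp)).trans (by simp)
  · have := hu ⟨b, Ideal.subset_span (by simp)⟩
    rw [← this]
    exact (val _ 0 1 (by simp)).trans (by simp)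

theorem leftPInjective_of_two {R : Type*} [Ring R] (h : IsLeftNInjective 2 R) :
    LeftPInjective R := fun a b hab => by
  obtain ⟨u, hu, -⟩ := exists_mul_of_two h a a b b (fun x y hxy => by
    rw [← add_mul] at hxy ⊢; exact hab _ hxy)
  exact ⟨u, hu.symm⟩

/-- The element `c` represents the projection of `Ra ⊕ Rb` onto `Ra`. -/
theorem separatesIndependent_of_two {R : Type*} [Ring R] (h : IsLeftNInjective 2 R) :
    SeparatesIndependent R := fun a b hab => by
  refine exists_mul_of_two h a b a 0 (fun x y hxy => ?_)
  rw [mul_zero, add_zero]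
  exact hab x (-y) (by rw [neg_mul]; exact eq_neg_of_add_eq_zero_left hxy)

/-! ### Chain conditions, uniform left ideals and idempotents -/

theorem exists_maximal_rightIdeal {R : Type*} [Ring R] (hN : IsRightNoetherianRing R)
    (P : Submodule Rᵐᵒᵖ R → Prop) (h : ∃ T, P T) : ∃ T, P T ∧ ∀ T', P T' → ¬ T < T' := by
  have : IsNoetherian Rᵐᵒᵖ R := hN
  obtain ⟨T, hT, hm⟩ := set_has_maximal_iff_noetherian.2 this {T | P T} h
  exact ⟨T, hT, hm⟩

/-- Choose `sa ≠ 0` with maximal right annihilator, so that every nonzero multiple of `sa` has the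
same one. An element separating two independent multiples kills one of them, hence kills `sa` and
the other as well, although it fixes the latter. -/
theorem exists_uniform {R : Type*} [Ring R] (hN : IsRightNoetherianRing R)
    (h2 : SeparatesIndependent R) (a : R) (ha : a ≠ 0) :
    ∃ s, IsUniformIdeal (Ideal.span {s * a}) := by
  obtain ⟨T, ⟨s, hs, rfl⟩, hm⟩ := exists_maximal_rightIdeal hN
    (fun T => ∃ s, s * a ≠ 0 ∧ T = rightAnn {s * a}) ⟨_, 1, by simpa using ha, rfl⟩
  have hmax : ∀ x, x * (s * a) ≠ 0 → ∀ y, x * (s * a) * y = 0 → s * a * y = 0 := by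
    intro x hx y hy
    by_contra hne
    refine hm (rightAnn {x * (s * a)}) ⟨x * s, by rwa [mul_assoc], by rw [mul_assoc]⟩
      (lt_of_le_of_ne (fun z hz => ?_) fun h => hne ?_)
    · rw [mem_rightAnn_singleton] at hz ⊢
      rw [mul_assoc, hz, mul_zero]
    · rw [← mem_rightAnn_singleton, h, mem_rightAnn_singleton]; exact hy
  refine ⟨s, by simpa using hs, fun p hp q hq hp0 hq0 => ?_⟩
  obtain ⟨x, rfl⟩ := Ideal.mem_span_singleton'.1 hp
  obtain ⟨y, rfl⟩ := Ideal.mem_span_singleton'.1 hq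
  by_contra hcon
  push Not at hcon
  obtain ⟨c, hc1, hc2⟩ := h2 _ _ hcon
  have h1 := hmax y hq0 c hc2
  apply hp0
  rw [← hc1, mul_assoc, h1, mul_zero]

/-- Powers of an element of a right noetherian ring have stabilizing right annihilators. -/
theorem exists_pow_stable {R : Type*} [Ring R] (hN : IsRightNoetherianRing R) (d : R) :
    ∃ n, ∀ w, d ^ (n + 1) * w = 0 → d ^ n * w = 0 := by
  obtain ⟨T, ⟨n, rfl⟩, hm⟩ := exists_maximal_rightIdeal hN
    (fun T => ∃ n, T = rightAnn {d ^ n}) ⟨_, 0, rfl⟩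
  refine ⟨n, fun w hw => ?_⟩
  by_contra hne
  refine hm (rightAnn {d ^ (n + 1)}) ⟨_, rfl⟩ (lt_of_le_of_ne (fun z hz => ?_) fun h => hne ?_)
  · rw [mem_rightAnn_singleton] at hz ⊢
    rw [pow_succ', mul_assoc, hz, mul_zero]
  · rw [← mem_rightAnn_singleton, h, mem_rightAnn_singleton]; exact hw

theorem mul_eq_one_symm_of_rightNoetherian {R : Type*} [Ring R] (hN : IsRightNoetherianRing R)
    {k u : R} (h : k * u = 1) : u * k = 1 := by
  obtain ⟨n, hn⟩ := exists_pow_stable hN k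
  have hp : k ^ n * u ^ n = 1 := pow_mul_pow_eq_one n h
  have := hn (u ^ n * (1 - u * k)) (by
    rw [pow_succ', mul_assoc, ← mul_assoc (k ^ n), hp, one_mul, mul_sub, ← mul_assoc, h]; simp)
  rw [← mul_assoc, hp, one_mul, sub_eq_zero] at this
  exact this.symm

/-- P-injectivity gives `d = d²r`, so `d ∈ dⁿR` for all `n`. Then `d - drd` lies in `dⁿR` and is
killed by `d`; once the annihilators of powers stabilize it must vanish. -/
theorem exists_inner_inverse {R : Type*} [Ring R] (hN : IsRightNoetherianRing R)
    (hP : LeftPInjective R) (d : R) (hd : ∀ x, x * d * d = 0 → x * d = 0) :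
    ∃ s, d = d * s * d := by
  obtain ⟨r, hr⟩ := hP (d * d) d (fun x hx => hd x (by rwa [mul_assoc]))
  obtain ⟨n, hn⟩ := exists_pow_stable hN d
  have hpow : ∀ n : ℕ, d = d ^ n * d * r ^ n := by
    intro n
    induction n with
    | zero => simp
    | succ n ih =>
      calc d = d ^ n * d * r ^ n := ih
        _ = d ^ n * (d * d * r) * r ^ n := by rw [← hr]
        _ = _ := by rw [pow_succ, pow_succ']; simp only [mul_assoc]
  refine ⟨r, ?_⟩
  have h0 : d * (d - d * r * d) = 0 := by
    rw [mul_sub, ← mul_assoc, ← mul_assoc, ← hr, sub_self]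
  have h1 : d - d * r * d = d ^ n * (d * r ^ n * (1 - r * d)) := by
    calc d - d * r * d = d * (1 - r * d) := by noncomm_ring
      _ = (d ^ n * d * r ^ n) * (1 - r * d) := by rw [← hpow n]
      _ = _ := by simp only [mul_assoc]
  rw [h1, ← mul_assoc, ← pow_succ'] at h0
  rw [← sub_eq_zero, h1]
  exact hn _ h0

/-- An annihilator-preserving translate of an idempotent generates a summand. -/
theorem exists_idempotent_of_translate {R : Type*} [Ring R] (hP : LeftPInjective R) {f a : R}
    (hfa : f * a = a) (h : ∀ x, x * a = 0 → x * f = 0) :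
    ∃ u, f = a * u ∧ IsIdempotentElem (u * a) ∧ a * (u * a) = a := by
  obtain ⟨u, hu⟩ := hP a f h
  have : a * (u * a) = a := by rw [← mul_assoc, ← hu, hfa]
  exact ⟨u, hu, by rw [IsIdempotentElem, mul_assoc, this], this⟩

theorem span_mul_eq_of_mul_eq {R : Type*} [Ring R] {a u : R} (h : a * (u * a) = a) :
    Ideal.span {u * a} = Ideal.span {a} :=
  le_antisymm ((Ideal.span_singleton_le_iff_mem _).2 (Ideal.mem_span_singleton'.2 ⟨u, rfl⟩))
    ((Ideal.span_singleton_le_iff_mem _).2 (Ideal.mem_span_singleton'.2 ⟨a, h⟩))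

theorem IsUniformIdeal.eq_span_of_idempotent {R : Type*} [Ring R] {C : Ideal R}
    (hC : IsUniformIdeal C) {g : R} (hg : IsIdempotentElem g) (hgC : g ∈ C) (hg0 : g ≠ 0) :
    C = Ideal.span {g} := by
  refine le_antisymm (fun x hx => ?_) ((Ideal.span_singleton_le_iff_mem _).2 hgC)
  by_contra hne
  have hx' : x - x * g ≠ 0 := fun h => hne (Ideal.mem_span_singleton'.2 ⟨x, (sub_eq_zero.1 h).symm⟩)
  obtain ⟨p, q, hpq, h0⟩ := hC.2 _ (C.sub_mem hx (C.mul_mem_left x hgC)) _ hgC hx' hg0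
  have : q * g * g = 0 := by rw [← hpq, mul_assoc, sub_mul, mul_assoc x, hg.eq, sub_self, mul_zero]
  rw [mul_assoc, hg.eq, ← hpq] at this
  exact h0 this

theorem IsUniformIdeal.exists_idempotent_of_injective {R : Type*} [Ring R]
    (hN : IsRightNoetherianRing R) (hP : LeftPInjective R) {C : Ideal R} (hC : IsUniformIdeal C)
    {d : R} (hd : d ∈ C) (hinj : ∀ x ∈ C, x * d = 0 → x = 0) :
    ∃ g, IsIdempotentElem g ∧ C = Ideal.span {g} ∧ C = Ideal.span {d} := by
  obtain ⟨s, hs⟩ := exists_inner_inverse hN hP d (fun x hx => hinj _ (C.mul_mem_left x hd) hx)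
  have hs' : d * (s * d) = d := by rw [← mul_assoc]; exact hs.symm
  have hg : IsIdempotentElem (s * d) := by rw [IsIdempotentElem, mul_assoc, hs']
  have hg0 : s * d ≠ 0 := by
    intro h0
    apply hC.1
    rw [eq_bot_iff]
    intro x hx
    have : d = 0 := by rw [← hs', h0, mul_zero]
    exact hinj x hx (by rw [this, mul_zero])
  have := hC.eq_span_of_idempotent hg (C.mul_mem_left s hd) hg0
  exact ⟨s * d, hg, this, this.trans (span_mul_eq_of_mul_eq hs')⟩

theorem IsUniformIdeal.image {R : Type*} [Ring R] {C : Ideal R} (hC : IsUniformIdeal C) {r : R}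
    (hinj : ∀ x ∈ C, x * r = 0 → x = 0) {D : Ideal R} (hD : ∀ y, y ∈ D ↔ ∃ x ∈ C, x * r = y) :
    IsUniformIdeal D := by
  constructor
  · obtain ⟨x, hx, hx0⟩ := Submodule.exists_mem_ne_zero_of_ne_bot hC.1
    intro h
    have : x * r ∈ D := (hD _).2 ⟨x, hx, rfl⟩
    rw [h] at this
    exact hx0 (hinj x hx this)
  · intro a ha b hb ha0 hb0
    obtain ⟨a', ha', rfl⟩ := (hD _).1 ha
    obtain ⟨b', hb', rfl⟩ := (hD _).1 hb
    obtain ⟨x, y, hxy, h0⟩ := hC.2 a' ha' b' hb' (fun h => ha0 (by rw [h, zero_mul]))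
      (fun h => hb0 (by rw [h, zero_mul]))
    refine ⟨x, y, by rw [← mul_assoc, hxy, mul_assoc], fun h => h0 ?_⟩
    exact hinj _ (C.mul_mem_left x ha') (by rw [mul_assoc, h])

/-- The hypothesis says that `Rt` meets the left annihilator of `c` in zero, so `t = tcr` for some
`r`. Right multiplication by `r` moves `C` isomorphically onto a left ideal `D` containing `t`; the
idempotent is found in `D` and carried back. -/
theorem IsUniformIdeal.exists_idempotent {R : Type*} [Ring R]
    (hN : IsRightNoetherianRing R) (hP : LeftPInjective R) {C : Ideal R} (hC : IsUniformIdeal C)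
    {c t : R} (hc : c ∈ C) (ht : t ≠ 0) (h : ∀ x, x * t * c = 0 → x * t = 0) :
    ∃ g, IsIdempotentElem g ∧ C = Ideal.span {g} := by
  obtain ⟨r, hr⟩ := hP (t * c) t (fun x hx => h x (by rwa [mul_assoc]))
  have htc : t * c ≠ 0 := fun h0 => ht (by rw [hr, h0, zero_mul])
  have htcC : t * c ∈ C := C.mul_mem_left t hc
  have hinj : ∀ x ∈ C, x * r = 0 → x = 0 := by
    intro x hx hxr
    by_contra hx0
    obtain ⟨p, q, hpq, h0⟩ := hC.2 x hx _ htcC hx0 htc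
    have : q * t = 0 := by rw [hr, ← mul_assoc, ← hpq, mul_assoc, hxr, mul_zero]
    rw [hpq, ← mul_assoc, this, zero_mul] at h0
    exact h0 rfl
  let D : Ideal R := Submodule.map (LinearMap.toSpanSingleton R R r) C
  have hDm : ∀ y, y ∈ D ↔ ∃ x ∈ C, x * r = y := fun y => by
    simp [D, Submodule.mem_map]
  have hD := hC.image hinj hDm
  have htD : t ∈ D := (hDm t).2 ⟨t * c, htcC, hr.symm⟩
  -- Right multiplication by `cr` fixes `t`; since `D` is uniform, its kernel on `D` would meet `Rt`
  -- if it were nonzero.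
  obtain ⟨g, hg, hDg, -⟩ := hD.exists_idempotent_of_injective hN hP (d := c * r)
    ((hDm _).2 ⟨c, hc, rfl⟩) (by
      intro x hx hx0
      by_contra hne
      obtain ⟨p, q, hpq, h0⟩ := hD.2 x hx t htD hne ht
      apply h0
      calc p * x = q * t := hpq
        _ = q * t * (c * r) := by
          conv_lhs => rw [hr]
          simp only [mul_assoc]
        _ = p * (x * (c * r)) := by rw [← hpq, mul_assoc]
        _ = 0 := by rw [hx0, mul_zero])
  have hgD : g ∈ D := by rw [hDg]; exact Ideal.mem_span_singleton_self g
  obtain ⟨a, ha, rfl⟩ := (hDm g).1 hgD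
  have hCa : C = Ideal.span {a} := by
    refine le_antisymm (fun x hx => ?_) ((Ideal.span_singleton_le_iff_mem _).2 ha)
    have : x * r ∈ D := (hDm _).2 ⟨x, hx, rfl⟩
    rw [hDg] at this
    obtain ⟨y, hy⟩ := Ideal.mem_span_singleton'.1 this
    have := hinj (x - y * a) (C.sub_mem hx (C.mul_mem_left y ha)) (by
      rw [sub_mul, ← hy, mul_assoc, sub_self])
    rw [sub_eq_zero.1 this]
    exact Ideal.mem_span_singleton'.2 ⟨y, rfl⟩
  obtain ⟨u, hu⟩ := hP (a * r) a (fun x hx => hinj _ (C.mul_mem_left x ha) (by rwa [mul_assoc]))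
  have hara : a * (r * a) = a := by
    calc a * (r * a) = a * r * (a * r * u) := by rw [← hu, mul_assoc]
      _ = a := by rw [← mul_assoc, hg.eq, ← hu]
  exact ⟨r * a, by rw [IsIdempotentElem, mul_assoc, hara],
    hCa.trans (span_mul_eq_of_mul_eq hara).symm⟩

/-! ### Complements and uniform idempotents -/

/-- If `1 = k + c`, the left annihilators of `k` and `c` meet in zero. The latter is essential, so
the former is zero; P-injectivity gives `ku = 1`, and Dedekind finiteness gives `uk = 1`. -/
theorem isSmallLeftIdeal_of_essential_leftAnn {R : Type*} [Ring R]
    (hN : IsRightNoetherianRing R) (hP : LeftPInjective R) {C : Ideal R}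
    (h : ∀ c ∈ C, ∀ t, t ≠ 0 → ∃ x, x * t * c = 0 ∧ x * t ≠ 0) : IsSmallLeftIdeal C := by
  intro K hK
  have h1 : (1 : R) ∈ K ⊔ C := by rw [hK]; trivial
  obtain ⟨k, hk, c, hc, hkc⟩ := Submodule.mem_sup.1 h1
  obtain ⟨u, hu⟩ := hP k 1 (fun t ht => by
    by_contra hne
    rw [mul_one] at hne
    obtain ⟨x, hx, hx0⟩ := h c hc t hne
    apply hx0
    rw [← mul_one (x * t), ← hkc, mul_add, hx, mul_assoc, ht, mul_zero, add_zero])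
  have := mul_eq_one_symm_of_rightNoetherian hN hu.symm
  rw [Ideal.eq_top_iff_one, ← this]
  exact K.mul_mem_left u hk

theorem exists_maximal_disjoint {R : Type*} [Ring R] (U S : Ideal R) (h : U ⊓ S = ⊥) :
    ∃ C, U ≤ C ∧ IsComplementTo C S := by
  obtain ⟨C, hUC, hC⟩ := zorn_le_nonempty₀ {N : Ideal R | N ⊓ S = ⊥} (by
    intro c hc hchain y hy
    refine ⟨sSup c, ?_, fun z hz => le_sSup hz⟩
    change sSup c ⊓ S = ⊥
    rw [← disjoint_iff, hchain.directedOn.disjoint_sSup_left]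
    intro a ha
    exact disjoint_iff.2 (hc ha)) U h
  exact ⟨C, hUC, hC⟩

/-- Take `S` a complement to `U`, then `C ⊇ U` a complement to `S`. Maximality of `S` makes `U`
essential in `C`, and uniformity passes to essential extensions. -/
theorem IsUniformIdeal.exists_complement {R : Type*} [Ring R] {U : Ideal R}
    (hU : IsUniformIdeal U) : ∃ C, U ≤ C ∧ IsComplementSubmodule C ∧ IsUniformIdeal C := by
  obtain ⟨S, -, hS⟩ := exists_maximal_disjoint ⊥ U (by simp)
  obtain ⟨C, hUC, hC⟩ := exists_maximal_disjoint U S (by rw [inf_comm]; exact hS.1)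
  have ess : ∀ a ∈ C, a ≠ 0 → ∃ x, x * a ∈ U ∧ x * a ≠ 0 := by
    intro a ha ha0
    by_contra hcon
    push Not at hcon
    have hle : S ⊔ Ideal.span {a} ≤ S := hS.2 (by
      change (S ⊔ Ideal.span {a}) ⊓ U = ⊥
      rw [eq_bot_iff]
      rintro u ⟨hu, huU⟩
      obtain ⟨s, hs, y, hy, rfl⟩ := Submodule.mem_sup.1 hu
      obtain ⟨x, rfl⟩ := Ideal.mem_span_singleton'.1 hy
      have hs0 : s ∈ C ⊓ S := ⟨by
        have := C.sub_mem (hUC huU) (C.mul_mem_left x ha)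
        rwa [add_sub_cancel_right] at this, hs⟩
      rw [show C ⊓ S = ⊥ from hC.1, Submodule.mem_bot] at hs0
      rw [hs0, zero_add] at huU ⊢
      exact hcon x huU) le_sup_left
    have : a ∈ C ⊓ S := ⟨ha, hle (le_sup_right (a := S) (Ideal.mem_span_singleton_self a))⟩
    rw [show C ⊓ S = ⊥ from hC.1, Submodule.mem_bot] at this
    exact ha0 this
  refine ⟨C, hUC, ⟨S, hC⟩, fun h => hU.1 (eq_bot_iff.2 (h ▸ hUC)), fun a ha b hb ha0 hb0 => ?_⟩
  obtain ⟨x, hx, hx0⟩ := ess a ha ha0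
  obtain ⟨y, hy, hy0⟩ := ess b hb hb0
  obtain ⟨p, q, hpq, h0⟩ := hU.2 _ hx _ hy hx0 hy0
  exact ⟨p * x, q * y, by simpa only [mul_assoc] using hpq, by simpa only [mul_assoc] using h0⟩

/-- Idempotents generating uniform left ideals. -/
def IsUniformIdempotent {R : Type*} [Ring R] (e : R) : Prop :=
  IsIdempotentElem e ∧ IsUniformIdeal (Ideal.span {e})

theorem exists_uniformIdempotent {R : Type*} [Ring R] (hN : IsRightNoetherianRing R)
    (hP : LeftPInjective R) (h2 : SeparatesIndependent R)
    (hC : ∀ I : Ideal R, I ≠ ⊥ → IsComplementSubmodule I → ¬ IsSmallLeftIdeal I)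
    (a : R) (ha : a ≠ 0) :
    ∃ g x y, IsUniformIdempotent g ∧ x * a = y * g ∧ x * a ≠ 0 := by
  obtain ⟨s, hs⟩ := exists_uniform hN h2 a ha
  obtain ⟨C, hsC, hCc, hCu⟩ := hs.exists_complement
  have hns := hC C hCu.1 hCc
  have : ¬ ∀ c ∈ C, ∀ t, t ≠ 0 → ∃ x, x * t * c = 0 ∧ x * t ≠ 0 :=
    fun h => hns (isSmallLeftIdeal_of_essential_leftAnn hN hP h)
  push Not at this
  obtain ⟨c, hc, t, ht, h⟩ := this
  obtain ⟨g, hg, rfl⟩ := hCu.exists_idempotent hN hP hc ht h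
  obtain ⟨y, hy⟩ := Ideal.mem_span_singleton'.1 (hsC (Ideal.mem_span_singleton_self _))
  exact ⟨g, s, y, ⟨hg, hCu⟩, hy.symm, by simpa using hs.1⟩

/-- An idempotent `e ≠ 1` in the span can be enlarged: a uniform `Rf` meeting `R(1-e)` is moved by
`1-e` onto some `Rg` with `ge = 0`, and `e + (1-e)g` generates a strictly larger right ideal. -/
theorem span_uniformIdempotents {R : Type*} [Ring R] (hN : IsRightNoetherianRing R)
    (hP : LeftPInjective R) (h2 : SeparatesIndependent R)
    (hC : ∀ I : Ideal R, I ≠ ⊥ → IsComplementSubmodule I → ¬ IsSmallLeftIdeal I) :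
    Ideal.span {e : R | IsUniformIdempotent e} = ⊤ := by
  obtain ⟨T, ⟨e, he, heS, rfl⟩, hm⟩ := exists_maximal_rightIdeal hN
    (fun T => ∃ e, IsIdempotentElem e ∧ e ∈ Ideal.span {e : R | IsUniformIdempotent e} ∧
      T = rightSpan e) ⟨_, 0, IsIdempotentElem.zero, Submodule.zero_mem _, rfl⟩
  by_cases he1 : e = 1
  · rw [Ideal.eq_top_iff_one, ← he1]; exact heS
  exfalso
  obtain ⟨f, p, q, ⟨hf, hfu⟩, hpq, h0⟩ := exists_uniformIdempotent hN hP h2 hC (1 - e)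
    (fun h => he1 (sub_eq_zero.1 h).symm)
  have h1e : (1 - e) * (1 - e) = 1 - e := he.one_sub.eq
  have hqf : q * f ∈ Ideal.span {f} := Ideal.mem_span_singleton'.2 ⟨q, rfl⟩
  -- Right multiplication by `1-e` fixes the nonzero element `qf = p(1-e)` of the uniform ideal
  -- `Rf`, hence is injective on `Rf`.
  have hinj : ∀ x ∈ Ideal.span {f}, x * (f * (1 - e)) = 0 → x = 0 := by
    intro x hx hx0
    obtain ⟨z, rfl⟩ := Ideal.mem_span_singleton'.1 hx
    rw [← mul_assoc, mul_assoc z, hf.eq] at hx0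
    by_contra hne
    obtain ⟨x, y, hxy, hne'⟩ := hfu.2 _ hx _ hqf hne (hpq ▸ h0)
    apply hne'
    rw [hxy, ← hpq, ← h1e, ← mul_assoc p, hpq, ← mul_assoc, ← hxy, mul_assoc, hx0, mul_zero]
  obtain ⟨u, hu, hg, hua⟩ := exists_idempotent_of_translate hP (f := f) (a := f * (1 - e))
    (by rw [← mul_assoc, hf.eq]) (fun x hx => hinj _ (Ideal.mem_span_singleton'.2 ⟨x, rfl⟩) (by
      rw [mul_assoc, ← mul_assoc f, hf.eq, hx]))
  set g := u * (f * (1 - e)) with hgdef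
  have hge : g * e = 0 := by
    rw [hgdef, mul_assoc, mul_assoc, sub_mul, one_mul, he.eq, sub_self, mul_zero, mul_zero]
  have hgu : IsUniformIdempotent g := by
    refine ⟨hg, hfu.image hinj fun y => ?_⟩
    rw [hgdef, span_mul_eq_of_mul_eq hua, Ideal.mem_span_singleton']
    constructor
    · rintro ⟨z, rfl⟩
      exact ⟨z * f, Ideal.mem_span_singleton'.2 ⟨z, rfl⟩, by
        rw [mul_assoc, ← mul_assoc f, hf.eq]⟩
    · rintro ⟨x, -, rfl⟩
      exact ⟨x, rfl⟩
  have hg0 : g ≠ 0 := by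
    intro h
    exact hgu.2.1 (by rw [h]; simp)
  have hidem : IsIdempotentElem (e + (1 - e) * g) := by
    have : (e + (1 - e) * g) * (e + (1 - e) * g)
      = e * e + (e - e * e) * g + (1 - e) * (g * e) + (1 - e) * (g * g - (g * e) * g) := by
      noncomm_ring
    rw [IsIdempotentElem, this, hge, he.eq, hg.eq]; simp
  refine hm (rightSpan (e + (1 - e) * g)) ⟨_, hidem, ?_, rfl⟩ (lt_of_le_of_ne ?_ ?_)
  · exact Ideal.add_mem _ heS (Ideal.mul_mem_left _ _ (Ideal.subset_span hgu))
  · intro x hx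
    obtain ⟨r, rfl⟩ := mem_rightSpan.1 hx
    refine mem_rightSpan.2 ⟨e * r, ?_⟩
    rw [← mul_assoc, add_mul, mul_assoc (1 - e), hge, he.eq, mul_zero, add_zero]
  · intro heq
    have : e + (1 - e) * g ∈ rightSpan e := by
      rw [heq]; exact mem_rightSpan.2 ⟨1, (mul_one _).symm⟩
    obtain ⟨r, hr⟩ := mem_rightSpan.1 this
    have h3 : (1 - e) * (e + (1 - e) * g) = 0 := by
      rw [hr, ← mul_assoc, sub_mul, one_mul, he.eq, sub_self, zero_mul]
    rw [mul_add, ← mul_assoc, h1e, sub_mul, one_mul, he.eq, sub_self, zero_add, sub_mul, one_mul,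
      sub_eq_zero] at h3
    apply hg0
    rw [← hg.eq]
    conv_lhs => rw [h3]
    rw [mul_assoc, ← mul_assoc g, hge, zero_mul, mul_zero]

/-! ### Locality of uniform idempotents modulo the Jacobson radical -/

theorem isUnit_one_sub_of_mem_jacobson {R : Type*} [Ring R] {j : R} (hj : j ∈ Ring.jacobson R) :
    IsUnit (1 - j) := by
  have key : ∀ i ∈ Ring.jacobson R, ∃ u, u * (1 - i) = 1 := by
    intro i hi
    by_contra hcon
    have hne : Ideal.span {1 - i} ≠ ⊤ := fun h => hcon (by
      have : (1 : R) ∈ Ideal.span {1 - i} := by rw [h]; trivial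
      exact Ideal.mem_span_singleton'.1 this)
    obtain ⟨M, hM, hle⟩ := Ideal.exists_le_maximal _ hne
    apply hM.ne_top
    rw [Ideal.eq_top_iff_one, ← sub_add_cancel 1 i]
    exact M.add_mem (hle (Ideal.mem_span_singleton_self _))
      (Ring.jacobson_le_of_isMaximal M hi)
  obtain ⟨u, hu⟩ := key j hj
  obtain ⟨v, hv⟩ := key (-(u * j)) (neg_mem (Ideal.mul_mem_left _ _ hj))
  have h1 : 1 - -(u * j) = u := by
    rw [sub_neg_eq_add, ← hu, mul_sub, mul_one, sub_add_cancel]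
  rw [h1] at hv
  have : v = 1 - j := by
    calc v = v * (u * (1 - j)) := by rw [hu, mul_one]
      _ = _ := by rw [← mul_assoc, hv, one_mul]
  exact ⟨⟨1 - j, u, this ▸ hv, hu⟩, rfl⟩

theorem exists_isMaximal_notMem {R : Type*} [Ring R] {x : R} (hx : x ∉ Ring.jacobson R) :
    ∃ M : Ideal R, M.IsMaximal ∧ x ∉ M := by
  rw [Ring.jacobson_eq_sInf_isMaximal, Ideal.mem_sInf] at hx
  push Not at hx
  exact hx

theorem IsUniformIdempotent.ne_zero {R : Type*} [Ring R] {e : R} (he : IsUniformIdempotent e) :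
    e ≠ 0 := fun h => he.2.1 (by rw [h]; simp)

theorem IsUniformIdempotent.notMem_jacobson {R : Type*} [Ring R] {e : R}
    (he : IsUniformIdempotent e) : e ∉ Ring.jacobson R := fun h => by
  have h0 : e * (1 - e) = 0 := by rw [mul_sub, mul_one, he.1.eq, sub_self]
  exact he.ne_zero ((isUnit_one_sub_of_mem_jacobson h).mul_left_eq_zero.1 h0)

/-- If a maximal `M` omits `x` and `1 = sx + m`, right multiplications by `esx` and `em` sum to the
identity of the uniform `Re`. Their kernels cannot both be nonzero, and an injective one is onto.
For `em` this would put `e`, hence `x = xe`, in `M`. -/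
theorem IsUniformIdempotent.exists_mul_eq {R : Type*} [Ring R] (hN : IsRightNoetherianRing R)
    (hP : LeftPInjective R) {e : R} (he : IsUniformIdempotent e) {x : R} (hxe : x * e = x)
    (hx : x ∉ Ring.jacobson R) : ∃ s, s * x = e := by
  obtain ⟨M, hM, hxM⟩ := exists_isMaximal_notMem hx
  have h1 : (1 : R) ∈ Ideal.span {x} ⊔ M := by
    rw [(hM.1.2 _ (lt_of_le_of_ne le_sup_right fun h => hxM (h ▸
      le_sup_left (a := Ideal.span {x}) (Ideal.mem_span_singleton_self x))))]; trivial
  obtain ⟨y, hy, m, hm, hsum⟩ := Submodule.mem_sup.1 h1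
  obtain ⟨s, rfl⟩ := Ideal.mem_span_singleton'.1 hy
  have hee : e = e * s * x + e * m := by
    rw [mul_assoc, ← mul_add, hsum, mul_one]
  have ha : e * s * x ∈ Ideal.span {e} :=
    Ideal.mem_span_singleton'.2 ⟨e * s * x, by rw [mul_assoc, hxe]⟩
  have hb : e * m ∈ Ideal.span {e} := by
    rw [show e * m = e - e * s * x from eq_sub_of_add_eq' hee.symm]
    exact Ideal.sub_mem _ (Ideal.mem_span_singleton_self e) ha
  by_cases hA : ∀ v ∈ Ideal.span {e}, v * (e * s * x) = 0 → v = 0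
  · obtain ⟨-, -, -, h⟩ := he.2.exists_idempotent_of_injective hN hP ha hA
    have : e ∈ Ideal.span {e * s * x} := h ▸ Ideal.mem_span_singleton_self e
    obtain ⟨t, ht⟩ := Ideal.mem_span_singleton'.1 this
    exact ⟨t * (e * s), by rw [mul_assoc, ht]⟩
  by_cases hB : ∀ v ∈ Ideal.span {e}, v * (e * m) = 0 → v = 0
  · obtain ⟨-, -, -, h⟩ := he.2.exists_idempotent_of_injective hN hP hb hB
    have : e ∈ Ideal.span {e * m} := h ▸ Ideal.mem_span_singleton_self e
    obtain ⟨t, ht⟩ := Ideal.mem_span_singleton'.1 this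
    refine absurd ?_ hxM
    rw [← hxe, ← ht, ← mul_assoc, ← mul_assoc]
    exact M.mul_mem_left _ hm
  push Not at hA hB
  obtain ⟨v, hv, hv0, hvne⟩ := hA
  obtain ⟨w, hw, hw0, hwne⟩ := hB
  obtain ⟨p, q, hpq, h0⟩ := he.2.2 v hv w hw hvne hwne
  exfalso
  apply h0
  obtain ⟨v', rfl⟩ := Ideal.mem_span_singleton'.1 hv
  calc p * (v' * e) = p * (v' * e) * e := by rw [mul_assoc p, mul_assoc v', he.1.eq]
    _ = p * (v' * e * (e * s * x)) + q * (w * (e * m)) := by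
      conv_lhs => rw [hee, mul_add]
      rw [← hee, ← mul_assoc q, ← hpq]
      simp only [mul_assoc]
    _ = 0 := by rw [hv0, hw0, mul_zero, mul_zero, add_zero]

/-- A map between two local summands that is nonzero modulo `J` is invertible modulo `J`. -/
theorem IsUniformIdempotent.exists_mul_sub_mem {R : Type*} [Ring R] (hN : IsRightNoetherianRing R)
    (hP : LeftPInjective R) {e f : R} (he : IsUniformIdempotent e) (hf : IsUniformIdempotent f)
    {y : R} (hy : e * y * f ∉ Ring.jacobson R) :
    ∃ z, z * (e * y * f) = f ∧ e - e * y * f * z * e ∈ Ring.jacobson R := by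
  obtain ⟨z, hz⟩ := hf.exists_mul_eq hN hP (by rw [mul_assoc, hf.1.eq]) hy
  refine ⟨z, hz, ?_⟩
  by_contra hne
  obtain ⟨t, ht⟩ := he.exists_mul_eq hN hP (x := e - e * y * f * z * e)
    (by rw [sub_mul, mul_assoc _ e e, he.1.eq]) hne
  have hzero : (e - e * y * f * z * e) * (y * f) = 0 := by
    have : e * y * f * z * e * (y * f) = e * y * f * (z * (e * y * f)) := by
      simp only [mul_assoc]
    rw [sub_mul, this, hz, mul_assoc (e * y), hf.1.eq, ← mul_assoc, sub_self]
  have : e * y * f = 0 := by rw [mul_assoc, ← ht, mul_assoc, hzero, mul_zero]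
  exact hy (this ▸ Submodule.zero_mem _)

/-! ### Finite frames and semisimplicity of `R/J` -/

/-- A finite set of uniform idempotents generating the unit left ideal. -/
structure IsUniformFrame {R : Type*} [Ring R] (E : Finset R) : Prop where
  uniform : ∀ e ∈ E, IsUniformIdempotent e
  span : Ideal.span (E : Set R) = ⊤

theorem exists_uniformFrame {R : Type*} [Ring R]
    (h : Ideal.span {e : R | IsUniformIdempotent e} = ⊤) : ∃ E : Finset R, IsUniformFrame E := by
  have h1 : (1 : R) ∈ Submodule.span R {e : R | IsUniformIdempotent e} := by
    change (1 : R) ∈ Ideal.span _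
    rw [h]; trivial
  obtain ⟨E, hE, h1E⟩ := Submodule.mem_span_finite_of_mem_span h1
  exact ⟨E, fun e he => hE he, (Ideal.eq_top_iff_one _).2 h1E⟩

theorem IsUniformFrame.mem_of_forall {R : Type*} [Ring R] {E : Finset R} (hE : IsUniformFrame E)
    (I : Ideal R) (h : ∀ e ∈ E, e ∈ I) (x : R) : x ∈ I := by
  have : (⊤ : Ideal R) ≤ I := by rw [← hE.span, Ideal.span_le]; exact h
  exact this trivial

theorem IsUniformFrame.exists_mul_ne_zero {R : Type*} [Ring R] {E : Finset R}
    (hE : IsUniformFrame E) {k : R} (hk : k ≠ 0) : ∃ e ∈ E, e * k ≠ 0 := by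
  by_contra hcon
  push Not at hcon
  have := hE.mem_of_forall (leftAnn {k}) (fun e he => by
    rw [mem_leftAnn]; rintro _ rfl; exact hcon e he) 1
  exact hk (by simpa using this k rfl)

theorem IsUniformFrame.exists_mul_notMem {R : Type*} [Ring R] {E : Finset R}
    (hE : IsUniformFrame E) (T : Submodule Rᵐᵒᵖ R) {x : R} (hx : x ∉ T) :
    ∃ e ∈ E, ∃ r, x * r * e ∉ T := by
  by_contra hcon
  push Not at hcon
  let I : Ideal R :=
    { carrier := {y | ∀ r, x * r * y ∈ T}
      add_mem' := fun ha hb r => by rw [mul_add]; exact T.add_mem (ha r) (hb r)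
      zero_mem' := fun r => by rw [mul_zero]; exact T.zero_mem
      smul_mem' := fun c y hy r => by
        rw [smul_eq_mul, ← mul_assoc, mul_assoc x]; exact hy _ }
  have : (1 : R) ∈ I := hE.mem_of_forall I (fun e he r => hcon e he r) 1
  exact hx (by simpa using this 1)

theorem IsUniformFrame.isSemisimpleRing_quotient {R : Type*} [Ring R]
    (hN : IsRightNoetherianRing R) (hP : LeftPInjective R) {E : Finset R}
    (hE : IsUniformFrame E) : IsSemisimpleRing (R ⧸ Ring.jacobson R) := by
  have hmod : IsSemisimpleModule R (R ⧸ Ring.jacobson R) := by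
    refine isSemisimpleModule_of_isSemisimpleModule_submodule (s := (E : Set R))
      (p := fun e => Submodule.map (Submodule.mkQ (Ring.jacobson R)) (Ideal.span {e}))
      (fun e he => ?_) ?_
    · have heu := hE.uniform e he
      suffices IsSimpleModule R (Submodule.map (Submodule.mkQ (Ring.jacobson R)) (Ideal.span {e}))
        from inferInstance
      rw [isSimpleModule_iff_toSpanSingleton_surjective]
      constructor
      · refine ⟨⟨⟨Submodule.mkQ _ e, Submodule.mem_map_of_mem (Ideal.mem_span_singleton_self e)⟩,
          0, fun h => heu.notMem_jacobson ?_⟩⟩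
        have := congrArg Subtype.val h
        exact (Submodule.Quotient.mk_eq_zero _).1 this
      · rintro ⟨_, ⟨x, hx, rfl⟩⟩ hne
        rintro ⟨_, ⟨y, hy, rfl⟩⟩
        obtain ⟨x', rfl⟩ := Ideal.mem_span_singleton'.1 hx
        obtain ⟨y', rfl⟩ := Ideal.mem_span_singleton'.1 hy
        obtain ⟨s, hs⟩ := heu.exists_mul_eq hN hP (x := x' * e)
          (by rw [mul_assoc, heu.1.eq]) (fun h => hne (Subtype.ext
            ((Submodule.Quotient.mk_eq_zero _).2 h)))
        refine ⟨y' * s, Subtype.ext ?_⟩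
        change (y' * s) • Submodule.mkQ _ (x' * e) = Submodule.mkQ _ (y' * e)
        rw [← map_smul, smul_eq_mul, mul_assoc, hs]
    · have : ⨆ e ∈ (E : Set R), Submodule.map (Submodule.mkQ (Ring.jacobson R)) (Ideal.span {e})
          = Submodule.map (Submodule.mkQ (Ring.jacobson R)) (Ideal.span (E : Set R)) := by
        conv_rhs => rw [Ideal.span, Submodule.span_eq_iSup_of_singleton_spans]
        simp only [Submodule.map_iSup]
      rw [this, hE.span, Submodule.map_top, Submodule.range_mkQ]
  -- The identity, semilinear along `R → R/J`, turns semisimplicity over `R` into semisimplicity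
  -- over `R/J`.
  let σ : (R ⧸ Ring.jacobson R) →ₛₗ[Ideal.Quotient.mk (Ring.jacobson R)] (R ⧸ Ring.jacobson R) :=
    ⟨.id _, fun _ _ => rfl⟩
  exact (σ.isSemisimpleModule_iff_of_bijective Function.bijective_id).1 hmod

/-! ### Nilpotency of the Jacobson radical -/

theorem exists_finset_rightGenerators {R : Type*} [Ring R] (hN : IsRightNoetherianRing R)
    (I : Ideal R) [I.IsTwoSided] :
    ∃ S : Finset R, (∀ s ∈ S, s ∈ I) ∧
      ∀ T : Submodule Rᵐᵒᵖ R, (∀ s ∈ S, s ∈ T) → ∀ y ∈ I, y ∈ T := by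
  have : IsNoetherian Rᵐᵒᵖ R := hN
  let I' : Submodule Rᵐᵒᵖ R :=
    { carrier := I
      add_mem' := I.add_mem
      zero_mem' := I.zero_mem
      smul_mem' := fun c y hy => by
        rw [MulOpposite.smul_eq_mul_unop]; exact I.mul_mem_right _ hy }
  obtain ⟨S, hS⟩ := IsNoetherian.noetherian I'
  refine ⟨S, fun s hs => ?_, fun T hT y hy => ?_⟩
  · have : s ∈ I' := hS ▸ Submodule.subset_span hs
    exact this
  · have : I' ≤ T := hS ▸ Submodule.span_le.2 hT
    exact this hy

/-- Otherwise P-injectivity gives `t = txr`, and `1 - xr` is a unit. -/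
theorem exists_mul_ne_zero_of_mem_jacobson {R : Type*} [Ring R] (hP : LeftPInjective R)
    {x : R} (hx : x ∈ Ring.jacobson R) {t : R} (ht : t ≠ 0) : ∃ s, s * t ≠ 0 ∧ s * t * x = 0 := by
  by_contra hcon
  push Not at hcon
  obtain ⟨r, hr⟩ := hP (t * x) t (fun s hs => by
    by_contra hne
    exact hcon s hne (by rwa [mul_assoc]))
  have h0 : t * (1 - x * r) = 0 := by rw [mul_sub, mul_one, ← mul_assoc, ← hr, sub_self]
  exact ht ((isUnit_one_sub_of_mem_jacobson (Ideal.mul_mem_right r _ hx)).mul_left_eq_zero.1 h0)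

theorem exists_mul_ne_zero_finset {R : Type*} [Ring R] (hP : LeftPInjective R) (S : Finset R)
    (hS : ∀ s ∈ S, s ∈ Ring.jacobson R) {t : R} (ht : t ≠ 0) :
    ∃ r, r * t ≠ 0 ∧ ∀ s ∈ S, r * t * s = 0 := by
  classical
  induction S using Finset.induction_on with
  | empty => exact ⟨1, by simpa using ht, by simp⟩
  | insert a S _ ih =>
    obtain ⟨r, hr, hrS⟩ := ih fun s hs => hS s (Finset.mem_insert_of_mem hs)
    obtain ⟨p, hp, hp0⟩ := exists_mul_ne_zero_of_mem_jacobson hP (hS a (Finset.mem_insert_self a S)) hr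
    refine ⟨p * r, by rwa [mul_assoc], fun s hs => ?_⟩
    rcases Finset.mem_insert.1 hs with rfl | hs
    · rw [mul_assoc p]; exact hp0
    · rw [mul_assoc p, mul_assoc p, hrS s hs, mul_zero]

theorem exists_mul_ne_zero_jacobson {R : Type*} [Ring R] (hN : IsRightNoetherianRing R)
    (hP : LeftPInjective R) {t : R} (ht : t ≠ 0) :
    ∃ r, r * t ≠ 0 ∧ ∀ j ∈ Ring.jacobson R, r * t * j = 0 := by
  obtain ⟨S, hS, hgen⟩ := exists_finset_rightGenerators hN (Ring.jacobson R)
  obtain ⟨r, hr, hrS⟩ := exists_mul_ne_zero_finset hP S hS ht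
  refine ⟨r, hr, fun j hj => ?_⟩
  have := hgen (rightAnn {r * t}) (fun s hs => mem_rightAnn_singleton.2 (hrS s hs)) j hj
  exact mem_rightAnn_singleton.1 this

theorem exists_mul_family_ne_zero {R : Type*} [Ring R] (hN : IsRightNoetherianRing R)
    (hP : LeftPInjective R) (Z : Finset R) (hZ : ∃ z ∈ Z, z ≠ 0) :
    ∃ s, (∃ z ∈ Z, s * z ≠ 0) ∧ ∀ z ∈ Z, ∀ j ∈ Ring.jacobson R, s * z * j = 0 := by
  classical
  induction Z using Finset.induction_on with
  | empty => simp at hZ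
  | insert a Z _ ih =>
    by_cases h : ∃ z ∈ Z, z ≠ 0
    · obtain ⟨s, ⟨z, hz, hsz⟩, hs⟩ := ih h
      by_cases hsa : s * a = 0
      · refine ⟨s, ⟨z, Finset.mem_insert_of_mem hz, hsz⟩, fun w hw j hj => ?_⟩
        rcases Finset.mem_insert.1 hw with rfl | hw
        · rw [hsa, zero_mul]
        · exact hs w hw j hj
      · obtain ⟨r, hr, hrj⟩ := exists_mul_ne_zero_jacobson hN hP hsa
        refine ⟨r * s, ⟨a, Finset.mem_insert_self a Z, by rwa [mul_assoc]⟩, fun w hw j hj => ?_⟩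
        rcases Finset.mem_insert.1 hw with rfl | hw
        · rw [mul_assoc r]; exact hrj j hj
        · rw [mul_assoc r, mul_assoc r, hs w hw j hj, mul_zero]
    · push Not at h
      have ha : a ≠ 0 := by
        obtain ⟨z, hz, hz0⟩ := hZ
        rcases Finset.mem_insert.1 hz with rfl | hz
        · exact hz0
        · exact absurd (h z hz) hz0
      obtain ⟨r, hr, hrj⟩ := exists_mul_ne_zero_jacobson hN hP ha
      refine ⟨r, ⟨a, Finset.mem_insert_self a Z, hr⟩, fun w hw j hj => ?_⟩
      rcases Finset.mem_insert.1 hw with rfl | hw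
      · exact hrj j hj
      · rw [h w hw, mul_zero, zero_mul]

theorem mul_eq_zero_of_mem_mul {R : Type*} [Ring R] {I K : Ideal R} {x : R}
    (h : ∀ a ∈ I, ∀ b ∈ K, x * a * b = 0) {y : R} (hy : y ∈ I * K) [I.IsTwoSided] : x * y = 0 := by
  let P : Ideal R :=
    { carrier := {y | ∀ r, x * r * y = 0}
      add_mem' := fun ha hb r => by rw [mul_add, ha r, hb r, add_zero]
      zero_mem' := fun r => mul_zero _
      smul_mem' := fun c y hy r => by
        rw [smul_eq_mul, ← mul_assoc, mul_assoc x]; exact hy _ }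
  have hle : I * K ≤ P := Ideal.mul_le.2 fun a ha b hb r => by
    have := h _ (I.mul_mem_left r ha) b hb
    rwa [← mul_assoc x, mul_assoc _ a] at *
  have := hle hy 1
  rwa [mul_one] at this

/-- If `Jⁿ ≠ 0`, some `s` satisfies `sJⁿ ≠ 0` and `sJⁿ⁺¹ = 0`, so the left annihilators of the
powers keep growing. They are two-sided, so the chain condition on right ideals applies. -/
theorem isNilpotent_jacobson {R : Type*} [Ring R] (hN : IsRightNoetherianRing R)
    (hP : LeftPInjective R) : IsNilpotent (Ring.jacobson R) := by
  set J := Ring.jacobson R with hJ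
  let A : ℕ → Submodule Rᵐᵒᵖ R := fun n =>
    { carrier := {x | ∀ y ∈ J ^ n, x * y = 0}
      add_mem' := fun ha hb y hy => by rw [add_mul, ha y hy, hb y hy, add_zero]
      zero_mem' := fun y _ => zero_mul y
      smul_mem' := fun c x hx y hy => by
        rw [MulOpposite.smul_eq_mul_unop, mul_assoc]
        exact hx _ (Ideal.mul_mem_left _ _ hy) }
  obtain ⟨T, ⟨n, rfl⟩, hm⟩ := exists_maximal_rightIdeal hN (fun T => ∃ n, T = A n) ⟨_, 0, rfl⟩
  refine ⟨n, ?_⟩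
  by_contra hne
  obtain ⟨y, hy, hy0⟩ := Submodule.exists_mem_ne_zero_of_ne_bot hne
  obtain ⟨Z, hZ, hgen⟩ := exists_finset_rightGenerators hN (J ^ n)
  obtain ⟨s, ⟨z, hz, hsz⟩, hs⟩ := exists_mul_family_ne_zero hN hP Z (by
    by_contra hcon
    push Not at hcon
    exact hy0 (by simpa using hgen ⊥ (fun s hs => by simpa using hcon s hs) y hy))
  refine hm (A (n + 1)) ⟨_, rfl⟩ (lt_of_le_of_ne (fun x hx w hw => ?_) fun h => hsz ?_)
  · exact hx w (Ideal.pow_le_pow_right (Nat.le_succ n) hw)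
  · have hsA : s ∈ A (n + 1) := by
      intro w hw
      rw [Submodule.pow_succ] at hw
      refine mul_eq_zero_of_mem_mul (fun a ha b hb => ?_) hw
      let T : Submodule Rᵐᵒᵖ R :=
        { carrier := {a | ∀ b ∈ J, s * a * b = 0}
          add_mem' := fun ha hb y hy => by rw [mul_add, add_mul, ha y hy, hb y hy, add_zero]
          zero_mem' := fun y _ => by rw [mul_zero, zero_mul]
          smul_mem' := fun c x hx y hy => by
            rw [MulOpposite.smul_eq_mul_unop, ← mul_assoc, mul_assoc]
            exact hx _ (Ideal.mul_mem_left _ _ hy) }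
      exact hgen T (fun z hz b hb => hs z hz b hb) a ha b hb
    rw [← h] at hsA
    exact hsA z (hZ z hz)

theorem exists_mul_ne_zero_annihilated {R : Type*} [Ring R]
    (hJ : IsNilpotent (Ring.jacobson R)) {x : R} (hx : x ≠ 0) :
    ∃ y, y * x ≠ 0 ∧ ∀ j ∈ Ring.jacobson R, j * (y * x) = 0 := by
  classical
  obtain ⟨n, hn⟩ := hJ
  have hex : ∃ m, ∀ y ∈ Ring.jacobson R ^ m, y * x = 0 :=
    ⟨n, fun y hy => by rw [hn] at hy; rw [(Submodule.mem_bot R).1 hy, zero_mul]⟩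
  have hmin := Nat.find_spec hex
  rcases h : Nat.find hex with _ | m
  · rw [h, Submodule.pow_zero, Ideal.one_eq_top] at hmin
    exact absurd (by simpa using hmin 1 trivial) hx
  · have := Nat.find_min hex (m := m) (by omega)
    push Not at this
    obtain ⟨y, hy, hyx⟩ := this
    refine ⟨y, hyx, fun j hj => ?_⟩
    rw [← mul_assoc]
    rw [h] at hmin
    exact hmin _ (by rw [Ideal.IsTwoSided.pow_succ]; exact Ideal.mul_mem_mul hj hy)

/-! ### Tops, simple left ideals and the Kasch property -/

/-- Two idempotents are linked if the Jacobson radical does not contain all maps between them. -/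
def Linked {R : Type*} [Ring R] (e f : R) : Prop := ∃ x, e * x * f ∉ Ring.jacobson R

theorem Linked.symm {R : Type*} [Ring R] (hN : IsRightNoetherianRing R)
    (hP : LeftPInjective R) {e f : R} (he : IsUniformIdempotent e) (hf : IsUniformIdempotent f)
    (h : Linked e f) : Linked f e := by
  obtain ⟨x, hx⟩ := h
  obtain ⟨z, hz, -⟩ := he.exists_mul_sub_mem hN hP hf hx
  refine ⟨z, fun hmem => hf.notMem_jacobson ?_⟩
  have : f = f * z * e * (x * f) := by
    calc f = f * f := hf.1.eq.symm
      _ = f * (z * (e * x * f)) := by rw [hz]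
      _ = _ := by simp only [mul_assoc]
  rw [this]
  exact Ideal.mul_mem_right _ _ hmem

theorem Linked.trans {R : Type*} [Ring R] (hN : IsRightNoetherianRing R)
    (hP : LeftPInjective R) {e f g : R} (he : IsUniformIdempotent e) (hf : IsUniformIdempotent f)
    (h : Linked e f) (h' : Linked f g) : Linked e g := by
  obtain ⟨x, hx⟩ := h
  obtain ⟨y, hy⟩ := h'
  obtain ⟨z, hz, -⟩ := he.exists_mul_sub_mem hN hP hf hx
  refine ⟨x * f * y, fun hmem => hy ?_⟩
  have : f * y * g = z * (e * (x * f * y) * g) := by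
    calc f * y * g = z * (e * x * f) * y * g := by rw [hz]
      _ = _ := by simp only [mul_assoc]
  rw [this]
  exact Ideal.mul_mem_left _ _ hmem

theorem Linked.refl {R : Type*} [Ring R] {e : R} (he : IsUniformIdempotent e) : Linked e e :=
  ⟨1, by rw [mul_one, he.1.eq]; exact he.notMem_jacobson⟩

/-- `k` is annihilated by the maximal left ideal attached to `h`. -/
def TopAnnihilates {R : Type*} [Ring R] (h k : R) : Prop :=
  ∀ y, y * h ∈ Ring.jacobson R → y * k = 0

theorem TopAnnihilates.transport {R : Type*} [Ring R] (hN : IsRightNoetherianRing R)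
    (hP : LeftPInjective R) {e f k : R} (he : IsUniformIdempotent e) (hf : IsUniformIdempotent f)
    (h : Linked e f) (hk : TopAnnihilates e k) (hk0 : k ≠ 0) :
    ∃ z, z * k ≠ 0 ∧ TopAnnihilates f (z * k) := by
  obtain ⟨x, hx⟩ := h
  obtain ⟨z, hz, hsub⟩ := he.exists_mul_sub_mem hN hP hf hx
  have hJ : ∀ j ∈ Ring.jacobson R, j * k = 0 := fun j hj => hk j (Ideal.mul_mem_right _ _ hj)
  refine ⟨f * z * e, fun h0 => hk0 ?_, fun y hy => ?_⟩
  · have h1 := hk (1 - e) (by rw [sub_mul, one_mul, he.1.eq, sub_self]; exact Submodule.zero_mem _)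
    have h2 := hJ _ hsub
    rw [sub_mul, one_mul, sub_eq_zero] at h1
    rw [sub_mul, sub_eq_zero] at h2
    rw [h1, h2]
    calc e * x * f * z * e * k = e * x * (f * z * e * k) := by simp only [mul_assoc]
      _ = 0 := by rw [h0, mul_zero]
  · have : y * (f * z * e * k) = y * f * (z * e) * k := by simp only [mul_assoc]
    rw [this]
    exact hJ _ (Ideal.mul_mem_right _ _ hy)

/-- Here `Rk` and `Rk'` are isomorphic simple left ideals, so `k' = ku`. Right multiplication by
`euf` is injective on `Rk`, hence on the uniform `Re`; P-injectivity then recovers `e` from `euf`,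
so `euf` is outside `J`. -/
theorem linked_of_topAnnihilates {R : Type*} [Ring R] (hN : IsRightNoetherianRing R)
    (hP : LeftPInjective R) {e f h k k' : R} (he : IsUniformIdempotent e)
    (hh : IsUniformIdempotent h) (hk : TopAnnihilates h k) (hk0 : k ≠ 0) (hke : k * e = k)
    (hk' : TopAnnihilates h k') (hk'0 : k' ≠ 0) (hkf : k' * f = k') : Linked e f := by
  have hann : ∀ l, TopAnnihilates h l → l ≠ 0 → ∀ y, y * l = 0 → y * h ∈ Ring.jacobson R := by
    intro l hl hl0 y hy
    by_contra hne
    obtain ⟨s, hs⟩ := hh.exists_mul_eq hN hP (x := y * h) (by rw [mul_assoc, hh.1.eq]) hne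
    have h1 := hl (1 - h) (by rw [sub_mul, one_mul, hh.1.eq, sub_self]; exact Submodule.zero_mem _)
    rw [sub_mul, one_mul, sub_eq_zero] at h1
    apply hl0
    rw [h1, ← hs, mul_assoc, mul_assoc, ← h1, hy, mul_zero]
  obtain ⟨u, hu⟩ := hP k k' (fun r hr => hk' r (hann k hk hk0 r hr))
  refine ⟨u, fun hmem => he.notMem_jacobson ?_⟩
  have hkw : k * (e * u * f) = k' := by
    rw [← mul_assoc, ← mul_assoc, hke, ← hu, hkf]
  obtain ⟨r, hr⟩ := hP (e * u * f) e (fun x hx => by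
    by_contra hne
    obtain ⟨p, q, hpq, h0⟩ := he.2.2 (x * e) (Ideal.mem_span_singleton'.2 ⟨x, rfl⟩) k
      (Ideal.mem_span_singleton'.2 ⟨k, hke⟩) hne hk0
    have hxe : x * e * (e * u * f) = 0 := by
      rw [← hx, ← mul_assoc, ← mul_assoc, mul_assoc x, he.1.eq]; simp only [mul_assoc]
    have hqk' : q * k' = 0 := by
      rw [← hkw, ← mul_assoc, ← hpq, mul_assoc p, hxe, mul_zero]
    apply h0
    rw [hpq]
    exact hk q (hann k' hk' hk'0 q hqk'))
  rw [hr]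
  exact Ideal.mul_mem_right _ _ hmem

/-- Sending `e` to the type of a simple left ideal inside `Re` is injective on linkage classes.
There are finitely many classes, so every type occurs. -/
theorem IsUniformFrame.exists_topAnnihilates {R : Type*} [Ring R]
    (hN : IsRightNoetherianRing R) (hP : LeftPInjective R) {E : Finset R}
    (hE : IsUniformFrame E) {f : R} (hf : f ∈ E) : ∃ k, k ≠ 0 ∧ TopAnnihilates f k := by
  have hJ := isNilpotent_jacobson hN hP
  have hQ : ∀ e : E, ∃ (h : E) (k : R), k ≠ 0 ∧ k * (e : R) = k ∧ TopAnnihilates (h : R) k := by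
    rintro ⟨e, he⟩
    obtain ⟨y, hy, hyJ⟩ := exists_mul_ne_zero_annihilated hJ (hE.uniform e he).ne_zero
    obtain ⟨h, hh, hhk⟩ := hE.exists_mul_ne_zero hy
    refine ⟨⟨h, hh⟩, h * (y * e), hhk, ?_, fun z hz => ?_⟩
    · rw [mul_assoc, mul_assoc y, (hE.uniform e he).1.eq]
    · rw [← mul_assoc]; exact hyJ _ hz
  let S : Setoid E :=
    { r := fun e f => Linked (e : R) f
      iseqv :=
        { refl := fun e => Linked.refl (hE.uniform e e.2)
          symm := fun {e f} h => h.symm hN hP (hE.uniform e e.2) (hE.uniform f f.2)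
          trans := fun {e f g} h h' => h.trans hN hP (hE.uniform e e.2) (hE.uniform f f.2) h' } }
  choose π k hk0 hke hk using hQ
  -- Only chosen representatives are used, so `π` need not respect linkage.
  let φ : Quotient S → Quotient S := fun q => ⟦π q.out⟧
  have hinj : Function.Injective φ := by
    intro q q' hqq
    have hl : Linked (π q.out : R) (π q'.out) := Quotient.exact hqq
    obtain ⟨z, hz0, hz⟩ := (hk q.out).transport hN hP (hE.uniform _ (π q.out).2)
      (hE.uniform _ (π q'.out).2) hl (hk0 q.out)
    have : Linked (q.out : R) q'.out :=
      linked_of_topAnnihilates hN hP (hE.uniform _ q.out.2) (hE.uniform _ (π q'.out).2) hz hz0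
        (by rw [mul_assoc, hke]) (hk q'.out) (hk0 _) (hke _)
    rw [← Quotient.out_eq q, ← Quotient.out_eq q']
    exact Quotient.sound this
  obtain ⟨q, hq⟩ := Finite.surjective_of_injective hinj ⟦⟨f, hf⟩⟧
  have hl : Linked (π q.out : R) f := Quotient.exact hq
  obtain ⟨z, hz0, hz⟩ := (hk q.out).transport hN hP (hE.uniform _ (π q.out).2)
      (hE.uniform f hf) hl (hk0 q.out)
  exact ⟨_, hz0, hz⟩

/-- Every maximal left ideal annihilates a nonzero element. -/
def LeftKasch (R : Type*) [Ring R] : Prop :=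
  ∀ M : Ideal R, M.IsMaximal → ∃ q : R, q ≠ 0 ∧ ∀ m ∈ M, m * q = 0

theorem IsUniformFrame.leftKasch {R : Type*} [Ring R]
    (hN : IsRightNoetherianRing R) (hP : LeftPInjective R) {E : Finset R}
    (hE : IsUniformFrame E) : LeftKasch R := by
  intro M hM
  obtain ⟨f, hf, hfM⟩ : ∃ f ∈ E, f ∉ M := by
    by_contra hcon
    push Not at hcon
    exact hM.ne_top ((Ideal.eq_top_iff_one _).2 (hE.mem_of_forall M hcon 1))
  have hfu := hE.uniform f hf
  obtain ⟨k, hk0, hk⟩ := hE.exists_topAnnihilates hN hP hf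
  have hJ : ∀ y, y * f ∈ M → y * f ∈ Ring.jacobson R := by
    intro y hy
    by_contra hne
    obtain ⟨s, hs⟩ := hfu.exists_mul_eq hN hP (x := y * f) (by rw [mul_assoc, hfu.1.eq]) hne
    exact hfM (hs ▸ M.mul_mem_left s hy)
  have h1 : (1 : R) ∈ Ideal.span {f} ⊔ M := by
    rw [(hM.1.2 _ (lt_of_le_of_ne le_sup_right fun h => hfM (h ▸
      le_sup_left (a := Ideal.span {f}) (Ideal.mem_span_singleton_self f))))]; trivial
  obtain ⟨y, hy, m, hm, hsum⟩ := Submodule.mem_sup.1 h1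
  obtain ⟨z, rfl⟩ := Ideal.mem_span_singleton'.1 hy
  refine ⟨z * k, fun h0 => hk0 ?_, fun m' hm' => ?_⟩
  · have := hk (f * z - 1) (hJ _ (by
      have : (f * z - 1) * f = f * (z * f + m) - f - f * m := by noncomm_ring
      rw [this, hsum, mul_one, sub_self, zero_sub]
      exact M.neg_mem (M.mul_mem_left f hm)))
    rw [sub_mul, one_mul, mul_assoc, h0, mul_zero, zero_sub, neg_eq_zero] at this
    exact this
  · rw [← mul_assoc]
    refine hk _ (hJ _ ?_)
    have : m' * z * f = m' * (z * f + m) - m' * m := by noncomm_ring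
    rw [this, hsum, mul_one]
    exact M.sub_mem hm' (M.mul_mem_left _ hm)

/-! ### The left annihilator of the radical and left chain conditions -/

theorem IsUniformFrame.right_separation {R : Type*} [Ring R]
    (hN : IsRightNoetherianRing R) (hP : LeftPInjective R) {E : Finset R}
    (hE : IsUniformFrame E) {e x s : R} (he : IsUniformIdempotent e) (hxe : x * e = x)
    (hxJ : ∀ j ∈ Ring.jacobson R, x * j = 0) (hs : s * x ≠ 0) {y : R} (hy : s * x * y = 0) :
    x * y = 0 := by
  by_contra hne
  obtain ⟨f, hf, r, hr⟩ := hE.exists_mul_notMem ⊥ (x := x * y) (by simpa using hne)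
  have hfu := hE.uniform f hf
  have hr' : x * y * r * f ≠ 0 := by simpa using hr
  have hnJ : e * (y * r) * f ∉ Ring.jacobson R := by
    intro hmem
    apply hr'
    have := hxJ _ hmem
    rw [← mul_assoc, ← mul_assoc, hxe, ← mul_assoc] at this
    exact this
  obtain ⟨z, -, hz⟩ := he.exists_mul_sub_mem hN hP hfu hnJ
  have h1 := hxJ _ hz
  rw [mul_sub, hxe, sub_eq_zero] at h1
  apply hs
  calc s * x = s * (x * (e * (y * r) * f * z * e)) := by rw [← h1]
    _ = s * (x * e) * y * (r * f * z * e) := by simp only [mul_assoc]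
    _ = 0 := by rw [hxe, hy, zero_mul]

/-- If `Rsx ≠ Rx`, the Kasch property gives `q ≠ 0` killed by all `y` with `yx ∈ Rsx`. P-injectivity
writes `q = xy`; then `sxy = 0`, and right separation forces `q = 0`. -/
theorem IsUniformFrame.mem_span_of_mem_span {R : Type*} [Ring R]
    (hN : IsRightNoetherianRing R) (hP : LeftPInjective R) {E : Finset R}
    (hE : IsUniformFrame E) {e x s : R} (he : IsUniformIdempotent e) (hxe : x * e = x)
    (hxJ : ∀ j ∈ Ring.jacobson R, x * j = 0) (hs : s * x ≠ 0) : ∃ t, t * (s * x) = x := by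
  by_contra hcon
  let I : Ideal R := Submodule.comap (LinearMap.toSpanSingleton R R x) (Ideal.span {s * x})
  have hI : ∀ y, y ∈ I ↔ y * x ∈ Ideal.span {s * x} := fun y => by simp [I]
  have hItop : I ≠ ⊤ := fun h => hcon (by
    have : (1 : R) ∈ I := by rw [h]; trivial
    rw [hI, one_mul] at this
    exact Ideal.mem_span_singleton'.1 this)
  obtain ⟨M, hM, hIM⟩ := Ideal.exists_le_maximal I hItop
  obtain ⟨q, hq0, hq⟩ := hE.leftKasch hN hP M hM
  obtain ⟨y, hy⟩ := hP x q (fun r hr => hq r (hIM ((hI r).2 (by rw [hr]; exact Submodule.zero_mem _))))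
  apply hq0
  rw [hy]
  refine hE.right_separation hN hP he hxe hxJ hs ?_
  rw [mul_assoc, ← hy]
  exact hq s (hIM ((hI s).2 (Ideal.mem_span_singleton_self _)))

theorem IsUniformFrame.exists_mul_eq_of_annihilated {R : Type*} [Ring R]
    (hN : IsRightNoetherianRing R) (hP : LeftPInjective R) {E : Finset R}
    (hE : IsUniformFrame E) {e x x' : R} (he : IsUniformIdempotent e) (hxe : x * e = x)
    (hx0 : x ≠ 0) (hxe' : x' * e = x')
    (hxJ' : ∀ j ∈ Ring.jacobson R, x' * j = 0) : ∃ t, t * x = x' := by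
  by_cases hx'0 : x' = 0
  · exact ⟨0, by rw [hx'0, zero_mul]⟩
  obtain ⟨p, q, hpq, h0⟩ := he.2.2 x (Ideal.mem_span_singleton'.2 ⟨x, hxe⟩) x'
    (Ideal.mem_span_singleton'.2 ⟨x', hxe'⟩) hx0 hx'0
  obtain ⟨t, ht⟩ := hE.mem_span_of_mem_span hN hP he hxe' hxJ' (hpq ▸ h0)
  exact ⟨t * p, by rw [mul_assoc, hpq, ht]⟩

theorem IsUniformFrame.isNoetherian_leftAnn_jacobson {R : Type*} [Ring R]
    (hN : IsRightNoetherianRing R) (hP : LeftPInjective R) {E : Finset R}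
    (hE : IsUniformFrame E) : IsNoetherian R (leftAnn (Ring.jacobson R : Set R)) := by
  set L := leftAnn (Ring.jacobson R : Set R) with hL
  have hpiece : ∀ e : E, IsNoetherian R (L ⊓ Ideal.span {(e : R)} : Ideal R) := by
    rintro ⟨e, he⟩
    have heu := hE.uniform e he
    rw [isNoetherian_submodule]
    intro N hNle
    by_cases hbot : N = ⊥
    · rw [hbot]; exact Submodule.fg_bot
    obtain ⟨x, hx, hx0⟩ := Submodule.exists_mem_ne_zero_of_ne_bot hbot
    have hmem : ∀ w ∈ N, w * e = w := fun w hw => by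
      obtain ⟨v, rfl⟩ := Ideal.mem_span_singleton'.1 (hNle hw).2
      rw [mul_assoc, heu.1.eq]
    have : N = Submodule.span R {x} := by
      refine le_antisymm (fun w hw => ?_) ((Submodule.span_singleton_le_iff_mem _ _).2 hx)
      obtain ⟨t, ht⟩ := hE.exists_mul_eq_of_annihilated hN hP heu (hmem x hx) hx0
        (hmem w hw) (hNle hw).1
      exact Submodule.mem_span_singleton.2 ⟨t, ht⟩
    rw [this]
    exact Submodule.fg_span_singleton x
  have hsup : IsNoetherian R (⨆ e : E, L ⊓ Ideal.span {(e : R)} : Ideal R) := isNoetherian_iSup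
  refine isNoetherian_of_le (t := ⨆ e : E, L ⊓ Ideal.span {(e : R)}) fun x hx => ?_
  have hmul : ∀ r, x * r ∈ L := fun r j hj => by
    rw [mul_assoc]; exact hx _ (Ideal.mul_mem_left _ _ hj)
  let I : Ideal R :=
    { carrier := {y | ∀ r, x * r * y ∈ ⨆ e : E, L ⊓ Ideal.span {(e : R)}}
      add_mem' := fun ha hb r => by rw [mul_add]; exact add_mem (ha r) (hb r)
      zero_mem' := fun r => by rw [mul_zero]; exact Submodule.zero_mem _
      smul_mem' := fun c y hy r => by
        rw [smul_eq_mul, ← mul_assoc, mul_assoc x]; exact hy _ }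
  have := hE.mem_of_forall I (fun e he r => Submodule.mem_iSup_of_mem (⟨e, he⟩ : E)
    ⟨by rw [mul_assoc]; exact hmul _, Ideal.mem_span_singleton'.2 ⟨x * r, rfl⟩⟩) 1 1
  simpa using this

/-- Multiplying by finitely many right generators of `J` maps the left annihilator of `Jⁿ⁺¹` to a
finite power of that of `Jⁿ`, with kernel killed by `J`. Nilpotency ends the induction. -/
theorem IsUniformFrame.isNoetherianRing {R : Type*} [Ring R]
    (hN : IsRightNoetherianRing R) (hP : LeftPInjective R) {E : Finset R}
    (hE : IsUniformFrame E) : IsNoetherianRing R := by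
  have hsoc := hE.isNoetherian_leftAnn_jacobson hN hP
  set J := Ring.jacobson R with hJ
  obtain ⟨S, hS, hgen⟩ := exists_finset_rightGenerators hN J
  have key : ∀ n : ℕ, IsNoetherian R (leftAnn ((J ^ n : Ideal R) : Set R)) := by
    intro n
    induction n with
    | zero =>
      have : leftAnn ((J ^ 0 : Ideal R) : Set R) = ⊥ := by
        rw [eq_bot_iff]
        intro x hx
        have := hx 1 (by rw [Submodule.pow_zero, Ideal.one_eq_top]; trivial)
        rwa [mul_one] at this
      rw [this]; infer_instance
    | succ n ih =>
      let ρ : leftAnn ((J ^ (n + 1) : Ideal R) : Set R) →ₗ[R]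
          (S → leftAnn ((J ^ n : Ideal R) : Set R)) :=
        LinearMap.pi fun s => ((LinearMap.toSpanSingleton R R (s : R)).comp
          (Submodule.subtype _)).codRestrict _ (fun x y hy => by
            change (x : R) * s * y = 0
            rw [mul_assoc]
            exact x.2 _ (by
              rw [Ideal.IsTwoSided.pow_succ]; exact Ideal.mul_mem_mul (hS s s.2) hy))
      have hker : ∀ x ∈ LinearMap.ker ρ, (x : R) ∈ leftAnn (J : Set R) := by
        intro x hx y hy
        have := hgen (rightAnn {(x : R)}) (fun s hs => mem_rightAnn_singleton.2 (by
          have := congrFun (LinearMap.mem_ker.1 hx) ⟨s, hs⟩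
          exact congrArg Subtype.val this)) y hy
        exact mem_rightAnn_singleton.1 this
      let ι : LinearMap.ker ρ →ₗ[R] leftAnn (J : Set R) :=
        ((Submodule.subtype _).comp (Submodule.subtype _)).codRestrict _
          (fun x => hker x.1 x.2)
      have : IsNoetherian R (LinearMap.ker ρ) := isNoetherian_of_injective ι (fun a b hab => by
        have := congrArg Subtype.val hab
        exact Subtype.ext (Subtype.ext this))
      exact isNoetherian_of_range_eq_ker (LinearMap.ker ρ).subtype ρ (by simp)
  obtain ⟨n, hn⟩ := isNilpotent_jacobson hN hP
  have htop : leftAnn ((J ^ n : Ideal R) : Set R) = ⊤ := by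
    rw [eq_top_iff]
    intro x _ y hy
    rw [hn] at hy
    rw [(Submodule.mem_bot R).1 hy, mul_zero]
  have := key n
  rw [htop] at this
  exact isNoetherian_top_iff.1 this

theorem IsUniformFrame.isArtinianRing {R : Type*} [Ring R]
    (hN : IsRightNoetherianRing R) (hP : LeftPInjective R) {E : Finset R}
    (hE : IsUniformFrame E) : IsArtinianRing R := by
  have h1 := hE.isNoetherianRing hN hP
  have : IsSemiprimaryRing R := ⟨hE.isSemisimpleRing_quotient hN hP, isNilpotent_jacobson hN hP⟩
  exact IsSemiprimaryRing.isNoetherian_iff_isArtinian.1 h1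

/-! ### Lengths and annihilators along covering relations -/

theorem CovBy.exists_sub_smul_mem {A M : Type*} [Ring A] [AddCommGroup M] [Module A M]
    {N N' : Submodule A M} (h : N ⋖ N') {s : M} (hs : s ∈ N') (hsN : s ∉ N) {w : M}
    (hw : w ∈ N') : ∃ a : A, w - a • s ∈ N := by
  have hsup : N ⊔ Submodule.span A {s} = N' := by
    refine (h.eq_or_eq le_sup_left (sup_le h.le ?_)).resolve_left fun h' => hsN ?_
    · exact (Submodule.span_singleton_le_iff_mem _ _).2 hs
    · rw [← h']; exact Submodule.mem_sup_right (Submodule.mem_span_singleton_self s)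
  rw [← hsup] at hw
  obtain ⟨n, hn, y, hy, rfl⟩ := Submodule.mem_sup.1 hw
  obtain ⟨a, rfl⟩ := Submodule.mem_span_singleton.1 hy
  exact ⟨a, by rwa [add_sub_cancel_right]⟩

theorem length_eq_add_length_quotient {A M : Type*} [Ring A] [AddCommGroup M] [Module A M]
    {N N' : Submodule A M} (h : N ≤ N') :
    Module.length A N' = Module.length A N + Module.length A (N' ⧸ N.submoduleOf N') :=
  Module.length_eq_add_of_exact (Submodule.inclusion h) (Submodule.mkQ _)
    (Submodule.inclusion_injective h) (Submodule.mkQ_surjective _) (by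
      rw [LinearMap.exact_iff, Submodule.ker_mkQ, Submodule.range_inclusion]; rfl)

theorem length_le_add_one {A M : Type*} [Ring A] [AddCommGroup M] [Module A M]
    {N N' : Submodule A M} (h : N ≤ N')
    (hs : ∀ y ∈ N', y ∉ N → ∀ y' ∈ N', ∃ a : A, y' - a • y ∈ N) :
    Module.length A N' ≤ Module.length A N + 1 := by
  rw [length_eq_add_length_quotient h]
  gcongr
  rcases subsingleton_or_nontrivial (N' ⧸ N.submoduleOf N') with hsub | hnt
  · rw [Module.length_eq_zero]; exact zero_le
  · suffices IsSimpleModule A (N' ⧸ N.submoduleOf N') from (Module.length_eq_one A _).le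
    rw [isSimpleModule_iff_toSpanSingleton_surjective]
    refine ⟨hnt, fun q hq w => ?_⟩
    obtain ⟨y, rfl⟩ := Submodule.mkQ_surjective _ q
    obtain ⟨y', rfl⟩ := Submodule.mkQ_surjective _ w
    obtain ⟨a, ha⟩ := hs y y.2 (fun hy => hq ((Submodule.Quotient.mk_eq_zero _).2 hy)) y' y'.2
    refine ⟨a, ?_⟩
    rw [LinearMap.toSpanSingleton_apply, ← map_smul, eq_comm, ← sub_eq_zero, ← map_sub]
    exact (Submodule.Quotient.mk_eq_zero _).2 ha

theorem CovBy.length_eq {A M : Type*} [Ring A] [AddCommGroup M] [Module A M]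
    {N N' : Submodule A M} (h : N ⋖ N') : Module.length A N' = Module.length A N + 1 := by
  refine le_antisymm (length_le_add_one h.le fun y hy hyN w hw =>
    h.exists_sub_smul_mem hy hyN hw) ?_
  rw [length_eq_add_length_quotient h.le]
  gcongr
  rw [Order.one_le_iff_pos, Module.length_pos_iff]
  obtain ⟨s, hs, hsN⟩ := SetLike.exists_of_lt h.lt
  exact ⟨⟨Submodule.mkQ _ ⟨s, hs⟩, 0, fun h0 => hsN (by
    have : (⟨s, hs⟩ : N') ∈ N.submoduleOf N' := (Submodule.Quotient.mk_eq_zero _).1 h0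
    exact this)⟩⟩

theorem le_of_forall_covBy_le {α β : Type*} [PartialOrder α] [WellFoundedLT α] [WellFoundedGT α]
    [Preorder β] (f : α → β) (hf : ∀ a b, a ⋖ b → f a ≤ f b) {a b : α} (hab : a ≤ b) :
    f a ≤ f b := by
  induction b using WellFoundedLT.induction with
  | ind b ih =>
    rcases hab.eq_or_lt with rfl | hlt
    · exact le_rfl
    · obtain ⟨c, hac, hcb⟩ := exists_le_covBy_of_lt hlt
      exact (ih c hcb.lt hac).trans (hf c b hcb)

/-- Since `L'/L` is simple and `sy ≠ 0`, `xsy = 0` forces `xs ∈ L`; P-injectivity then applies to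
`sy` and `v`. -/
theorem exists_mul_of_covBy {R : Type*} [Ring R] (hP : LeftPInjective R) {L L' : Ideal R}
    (h : L ⋖ L') {s y v : R} (hs : s ∈ L') (hy : y ∈ rightAnn (L : Set R)) (hsy : s * y ≠ 0)
    (hv : ∀ x, x * s ∈ L → x * v = 0) : ∃ u, v = s * y * u := by
  refine hP (s * y) v fun x hx => hv x ?_
  by_contra hxs
  obtain ⟨a, ha⟩ := h.exists_sub_smul_mem (L'.mul_mem_left x hs) hxs hs
  apply hsy
  have := hy _ ha
  rw [sub_mul, sub_eq_zero] at this
  rw [this, smul_eq_mul, mul_assoc, mul_assoc, hx, mul_zero]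

theorem mul_mem_of_covBy {R : Type*} [Ring R] {T T' : Submodule Rᵐᵒᵖ R} (h : T ⋖ T') {s : R}
    (hs : s ∈ T') {j : R} (hj : j ∈ Ring.jacobson R) : s * j ∈ T := by
  by_contra hne
  have hsj : s * j ∈ T' := by
    rw [← op_smul_eq_mul]; exact T'.smul_mem _ hs
  obtain ⟨a, ha⟩ := h.exists_sub_smul_mem hsj hne hs
  rw [MulOpposite.smul_eq_mul_unop] at ha
  obtain ⟨w, hw⟩ := isUnit_one_sub_of_mem_jacobson (Ideal.mul_mem_right a.unop _ hj)
  have h1 : s * w ∈ T := by rwa [hw, mul_sub, mul_one, ← mul_assoc]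
  have h2 : s ∈ T := by
    have := T.smul_mem (MulOpposite.op (w⁻¹ : Rˣ).1) h1
    rwa [op_smul_eq_mul, mul_assoc, Units.mul_inv, mul_one] at this
  apply hne
  rw [← op_smul_eq_mul]; exact T.smul_mem _ h2

/-- The right-hand counterpart has no P-injectivity to use. Instead `v` lies in `Re` and is killed
by `J`, so it is a multiple of any nonzero element of `Re`. -/
theorem IsUniformFrame.exists_mul_of_covBy {R : Type*} [Ring R]
    (hN : IsRightNoetherianRing R) (hP : LeftPInjective R) {E : Finset R}
    (hE : IsUniformFrame E) {T T' : Submodule Rᵐᵒᵖ R} (h : T ⋖ T') {e s y v : R} (he : e ∈ E)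
    (hs : s ∈ T') (hse : s * e = s) (hys : y * s ≠ 0)
    (hv : ∀ x, s * x ∈ T → v * x = 0) : ∃ u, u * (y * s) = v := by
  refine hE.exists_mul_eq_of_annihilated hN hP (hE.uniform e he) (by rw [mul_assoc, hse]) hys ?_
    (fun j hj => hv j (mul_mem_of_covBy h hs hj))
  have := hv (1 - e) (by rw [mul_sub, mul_one, hse, sub_self]; exact T.zero_mem)
  rw [mul_sub, mul_one, sub_eq_zero] at this
  exact this.symm

theorem rightAnn_anti {R : Type*} [Ring R] {S S' : Set R} (h : S ⊆ S') :
    rightAnn S' ≤ rightAnn S := fun _ hy x hx => hy x (h hx)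

theorem leftAnn_anti {R : Type*} [Ring R] {S S' : Set R} (h : S ⊆ S') :
    leftAnn S' ≤ leftAnn S := fun _ hy x hx => hy x (h hx)

theorem length_rightAnn_le {R : Type*} [Ring R] (hP : LeftPInjective R) {L L' : Ideal R}
    (h : L ⋖ L') : Module.length Rᵐᵒᵖ (rightAnn (L : Set R))
      ≤ Module.length Rᵐᵒᵖ (rightAnn (L' : Set R)) + 1 := by
  refine length_le_add_one (rightAnn_anti h.le) fun y hy hyL y' hy' => ?_
  obtain ⟨s, hs, hsy⟩ : ∃ s ∈ L', s * y ≠ 0 := by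
    by_contra hcon
    push Not at hcon
    exact hyL hcon
  have hsL : s ∉ L := fun hmem => hsy (hy s hmem)
  obtain ⟨u, hu⟩ := exists_mul_of_covBy hP h (v := s * y') hs hy hsy (fun x hx => by
    rw [← mul_assoc]; exact hy' _ hx)
  refine ⟨MulOpposite.op u, fun w hw => ?_⟩
  obtain ⟨a, ha⟩ := h.exists_sub_smul_mem hs hsL hw
  have hz : y' - y * u ∈ rightAnn (L : Set R) := Submodule.sub_mem _ hy' (by
    rw [← op_smul_eq_mul]; exact Submodule.smul_mem _ _ hy)
  have h1 := hz _ ha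
  rw [op_smul_eq_mul]
  rw [sub_mul, sub_eq_zero] at h1
  rw [h1, smul_eq_mul, mul_assoc, mul_sub, hu, mul_assoc, sub_self, mul_zero]

theorem IsUniformFrame.exists_mem_notMem_mul_eq {R : Type*} [Ring R] {E : Finset R}
    (hE : IsUniformFrame E) {T T' : Submodule Rᵐᵒᵖ R} (h : T < T') :
    ∃ e ∈ E, ∃ s ∈ T', s ∉ T ∧ s * e = s := by
  obtain ⟨s, hs, hsT⟩ := SetLike.exists_of_lt h
  obtain ⟨e, he, r, hr⟩ := hE.exists_mul_notMem T hsT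
  refine ⟨e, he, s * r * e, ?_, hr, by rw [mul_assoc, (hE.uniform e he).1.eq]⟩
  rw [mul_assoc, ← op_smul_eq_mul]
  exact T'.smul_mem _ hs

theorem CovBy.mul_ne_zero_of_leftAnn {R : Type*} [Ring R] {T T' : Submodule Rᵐᵒᵖ R} (h : T ⋖ T')
    {s y : R} (hs : s ∈ T') (hsT : s ∉ T) (hy : y ∈ leftAnn (T : Set R))
    (hyT : y ∉ leftAnn (T' : Set R)) : y * s ≠ 0 := by
  intro h0
  apply hyT
  intro w hw
  obtain ⟨a, ha⟩ := h.exists_sub_smul_mem hs hsT hw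
  have := hy _ ha
  rw [MulOpposite.smul_eq_mul_unop, mul_sub, ← mul_assoc, h0, zero_mul, sub_zero] at this
  exact this

theorem IsUniformFrame.length_leftAnn_le {R : Type*} [Ring R]
    (hN : IsRightNoetherianRing R) (hP : LeftPInjective R) {E : Finset R}
    (hE : IsUniformFrame E) {T T' : Submodule Rᵐᵒᵖ R} (h : T ⋖ T') :
    Module.length R (leftAnn (T : Set R)) ≤ Module.length R (leftAnn (T' : Set R)) + 1 := by
  obtain ⟨e, he, s, hs, hsT, hse⟩ := hE.exists_mem_notMem_mul_eq h.lt
  refine length_le_add_one (leftAnn_anti h.le) fun y hy hyT y' hy' => ?_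
  obtain ⟨u, hu⟩ := hE.exists_mul_of_covBy hN hP h (v := y' * s) he hs hse
    (h.mul_ne_zero_of_leftAnn hs hsT hy hyT) (fun x hx => by rw [mul_assoc]; exact hy' _ hx)
  refine ⟨u, ?_⟩
  by_contra hne
  refine h.mul_ne_zero_of_leftAnn hs hsT
    (Submodule.sub_mem _ hy' (Submodule.smul_mem _ u hy)) hne ?_
  rw [sub_mul, smul_eq_mul, mul_assoc, hu, sub_self]

theorem rightAnn_bot {R : Type*} [Ring R] : rightAnn ((⊥ : Ideal R) : Set R) = ⊤ := by
  rw [eq_top_iff]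
  rintro y - x hx
  rw [(Submodule.mem_bot R).1 hx, zero_mul]

theorem rightAnn_top {R : Type*} [Ring R] : rightAnn ((⊤ : Ideal R) : Set R) = ⊥ := by
  rw [eq_bot_iff]
  intro y hy
  simpa using hy 1 trivial

theorem leftAnn_bot {R : Type*} [Ring R] :
    leftAnn ((⊥ : Submodule Rᵐᵒᵖ R) : Set R) = ⊤ := by
  rw [eq_top_iff]
  rintro y - x hx
  rw [(Submodule.mem_bot Rᵐᵒᵖ).1 hx, mul_zero]

theorem leftAnn_top {R : Type*} [Ring R] :
    leftAnn ((⊤ : Submodule Rᵐᵒᵖ R) : Set R) = ⊥ := by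
  rw [eq_bot_iff]
  intro y hy
  simpa using hy 1 trivial

theorem length_rightAnn_bot {R : Type*} [Ring R] :
    Module.length Rᵐᵒᵖ (rightAnn ((⊥ : Ideal R) : Set R)) = Module.length Rᵐᵒᵖ R := by
  rw [rightAnn_bot, Module.length_top]

theorem length_rightAnn_top {R : Type*} [Ring R] :
    Module.length Rᵐᵒᵖ (rightAnn ((⊤ : Ideal R) : Set R)) = 0 := by
  rw [rightAnn_top, Module.length_bot]

theorem length_leftAnn_bot {R : Type*} [Ring R] :
    Module.length R (leftAnn ((⊥ : Submodule Rᵐᵒᵖ R) : Set R)) = Module.length R R := by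
  rw [leftAnn_bot, Module.length_top]

theorem length_leftAnn_top {R : Type*} [Ring R] :
    Module.length R (leftAnn ((⊤ : Submodule Rᵐᵒᵖ R) : Set R)) = 0 := by
  rw [leftAnn_top, Module.length_bot]

/-- A cover adds one to the second summand, which pays for the loss of at most one in the first. -/
theorem add_length_mono {A B M M' : Type*} [Ring A] [AddCommGroup M] [Module A M] [Ring B]
    [AddCommGroup M'] [Module B M'] [IsNoetherian A M] [IsArtinian A M]
    (p : Submodule A M → Submodule B M')
    (hp : ∀ N N', N ⋖ N' → Module.length B (p N) ≤ Module.length B (p N') + 1)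
    {N N' : Submodule A M} (h : N ≤ N') :
    Module.length B (p N) + Module.length A N ≤ Module.length B (p N') + Module.length A N' := by
  refine le_of_forall_covBy_le
    (fun N => Module.length B (p N) + Module.length A N) (fun N N' hc => ?_) h
  rw [hc.length_eq, add_comm (Module.length A N), ← add_assoc]
  gcongr
  exact hp N N' hc

theorem IsUniformFrame.isArtinian_op {R : Type*} [Ring R]
    (hN : IsRightNoetherianRing R) (hP : LeftPInjective R) {E : Finset R}
    (hE : IsUniformFrame E) : IsArtinian Rᵐᵒᵖ R := by
  have := hE.isArtinianRing hN hP
  have := hE.isNoetherianRing hN hP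
  have h := add_length_mono (fun L : Ideal R => rightAnn (L : Set R))
    (fun L L' hc => length_rightAnn_le hP hc) (bot_le : (⊥ : Ideal R) ≤ ⊤)
  simp only [length_rightAnn_bot, length_rightAnn_top, Module.length_top, Module.length_bot, add_zero,
    zero_add] at h
  have hne : Module.length Rᵐᵒᵖ R ≠ ⊤ := ne_top_of_le_ne_top Module.length_ne_top h
  exact (isFiniteLength_iff_isNoetherian_isArtinian.1 (Module.length_ne_top_iff.1 hne)).2

theorem IsUniformFrame.length_op_eq {R : Type*} [Ring R]
    (hN : IsRightNoetherianRing R) (hP : LeftPInjective R) {E : Finset R}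
    (hE : IsUniformFrame E) : Module.length Rᵐᵒᵖ R = Module.length R R := by
  have := hE.isArtinianRing hN hP
  have := hE.isNoetherianRing hN hP
  have := hE.isArtinian_op hN hP
  have : IsNoetherian Rᵐᵒᵖ R := hN
  have h := add_length_mono (fun L : Ideal R => rightAnn (L : Set R))
    (fun L L' hc => length_rightAnn_le hP hc) (bot_le : (⊥ : Ideal R) ≤ ⊤)
  have h' := add_length_mono (fun T : Submodule Rᵐᵒᵖ R => leftAnn (T : Set R))
    (fun T T' hc => hE.length_leftAnn_le hN hP hc) (bot_le : (⊥ : Submodule Rᵐᵒᵖ R) ≤ ⊤)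
  simp only [length_rightAnn_bot, length_rightAnn_top, length_leftAnn_bot, length_leftAnn_top, Module.length_top,
    Module.length_bot, add_zero, zero_add] at h h'
  exact le_antisymm h h'

theorem ENat.ne_of_add_add_one_le {a b c n : ℕ∞} (hn : n ≠ ⊤) (h : n ≤ a + b)
    (h' : c + (b + 1) ≤ n) : a ≠ c := by
  rintro rfl
  have h1 : a + b + 1 ≤ a + b := by rw [add_assoc]; exact h'.trans h
  have h2 : a + b ≠ ⊤ := fun h2 => hn (by
    rw [eq_top_iff, ← h2]
    exact (le_self_add.trans (add_assoc a b 1).le).trans h')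
  exact (ENat.add_one_le_iff h2).1 h1 |>.false

/-- The sum of the two lengths has the same finite value at `⊥` and `⊤`, so it is constant between
them and leaves no room for equal annihilators. -/
theorem IsUniformFrame.rightAnn_ne {R : Type*} [Ring R]
    (hN : IsRightNoetherianRing R) (hP : LeftPInjective R) {E : Finset R}
    (hE : IsUniformFrame E) {L L' : Ideal R} (h : L ⋖ L') :
    rightAnn (L : Set R) ≠ rightAnn (L' : Set R) := by
  have := hE.isArtinianRing hN hP
  have := hE.isNoetherianRing hN hP
  have h1 := add_length_mono (fun L : Ideal R => rightAnn (L : Set R))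
    (fun L L' hc => length_rightAnn_le hP hc) (bot_le : (⊥ : Ideal R) ≤ L)
  have h2 := add_length_mono (fun L : Ideal R => rightAnn (L : Set R))
    (fun L L' hc => length_rightAnn_le hP hc) (le_top : L' ≤ (⊤ : Ideal R))
  simp only [length_rightAnn_bot, length_rightAnn_top, Module.length_top, Module.length_bot, add_zero,
    zero_add, hE.length_op_eq hN hP, h.length_eq] at h1 h2
  exact fun heq => ENat.ne_of_add_add_one_le Module.length_ne_top h1 h2 (by rw [heq])

theorem IsUniformFrame.leftAnn_ne {R : Type*} [Ring R]
    (hN : IsRightNoetherianRing R) (hP : LeftPInjective R) {E : Finset R}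
    (hE : IsUniformFrame E) {T T' : Submodule Rᵐᵒᵖ R} (h : T ⋖ T') :
    leftAnn (T : Set R) ≠ leftAnn (T' : Set R) := by
  have := hE.isArtinianRing hN hP
  have := hE.isNoetherianRing hN hP
  have := hE.isArtinian_op hN hP
  have : IsNoetherian Rᵐᵒᵖ R := hN
  have h1 := add_length_mono (fun T : Submodule Rᵐᵒᵖ R => leftAnn (T : Set R))
    (fun T T' hc => hE.length_leftAnn_le hN hP hc) (bot_le : (⊥ : Submodule Rᵐᵒᵖ R) ≤ T)
  have h2 := add_length_mono (fun T : Submodule Rᵐᵒᵖ R => leftAnn (T : Set R))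
    (fun T T' hc => hE.length_leftAnn_le hN hP hc) (le_top : T' ≤ (⊤ : Submodule Rᵐᵒᵖ R))
  simp only [length_leftAnn_bot, length_leftAnn_top, Module.length_top, Module.length_bot, add_zero,
    zero_add, hE.length_op_eq hN hP, h.length_eq] at h1 h2
  exact fun heq => ENat.ne_of_add_add_one_le Module.length_ne_top h1 h2 (by rw [heq])

/-! ### Self-injectivity on both sides -/

theorem IsUniformFrame.exists_eq_mul_right {R : Type*} [Ring R]
    (hN : IsRightNoetherianRing R) (hP : LeftPInjective R) {E : Finset R}
    (hE : IsUniformFrame E) (I : Ideal R) (f : I →ₗ[R] R) :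
    ∃ u, ∀ x : I, f x = x * u := by
  have := hE.isArtinianRing hN hP
  have := hE.isNoetherianRing hN hP
  induction I using WellFoundedLT.induction with
  | ind I ih =>
  by_cases hI : I = ⊥
  · subst hI
    exact ⟨0, fun x => by rw [Subsingleton.elim x 0]; simp⟩
  obtain ⟨L, -, hL⟩ := exists_le_covBy_of_lt (bot_lt_iff_ne_bot.2 hI)
  obtain ⟨u, hu⟩ := ih L hL.lt (f.comp (Submodule.inclusion hL.le))
  have hu' : ∀ (x : R) (hx : x ∈ L), f ⟨x, hL.le hx⟩ = x * u := fun x hx => hu ⟨x, hx⟩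
  obtain ⟨y, hy, hyI⟩ := SetLike.exists_of_lt
    (lt_of_le_of_ne (rightAnn_anti hL.le) (hE.rightAnn_ne hN hP hL).symm)
  obtain ⟨s, hs, hsy⟩ : ∃ s ∈ I, s * y ≠ 0 := by
    by_contra hcon
    push Not at hcon
    exact hyI hcon
  have hsL : s ∉ L := fun hmem => hsy (hy s hmem)
  have hsmul : ∀ x, x * f ⟨s, hs⟩ = f ⟨x * s, I.mul_mem_left x hs⟩ := fun x => by
    rw [← smul_eq_mul, ← map_smul]; rfl
  obtain ⟨w, hw⟩ := _root_.exists_mul_of_covBy hP hL (v := f ⟨s, hs⟩ - s * u) hs hy hsy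
    (fun x hx => by rw [mul_sub, hsmul, hu' _ hx, mul_assoc, sub_self])
  -- Since `y` kills `L`, the correction `yw` leaves the values on `L` unchanged and repairs the
  -- value at `s`.
  refine ⟨u + y * w, fun x => ?_⟩
  obtain ⟨a, ha⟩ := hL.exists_sub_smul_mem hs hsL x.2
  have hx : f x = f ⟨_, hL.le ha⟩ + a * f ⟨s, hs⟩ := by
    rw [hsmul, ← map_add]; congr 1; ext; simp
  have hy0 := hy _ ha
  rw [hx, hu' _ ha, sub_eq_iff_eq_add.1 hw]
  rw [sub_mul, sub_eq_zero] at hy0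
  rw [mul_add (x : R), ← mul_assoc (x : R), hy0, smul_eq_mul]
  noncomm_ring

theorem IsUniformFrame.exists_eq_mul_left {R : Type*} [Ring R]
    (hN : IsRightNoetherianRing R) (hP : LeftPInjective R) {E : Finset R}
    (hE : IsUniformFrame E) (I : Submodule Rᵐᵒᵖ R) (f : I →ₗ[Rᵐᵒᵖ] R) :
    ∃ u, ∀ x : I, f x = u * x := by
  have := hE.isArtinian_op hN hP
  have : IsNoetherian Rᵐᵒᵖ R := hN
  induction I using WellFoundedLT.induction with
  | ind I ih =>
  by_cases hI : I = ⊥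
  · subst hI
    exact ⟨0, fun x => by rw [Subsingleton.elim x 0]; simp⟩
  obtain ⟨T, -, hT⟩ := exists_le_covBy_of_lt (bot_lt_iff_ne_bot.2 hI)
  obtain ⟨u, hu⟩ := ih T hT.lt (f.comp (Submodule.inclusion hT.le))
  have hu' : ∀ (x : R) (hx : x ∈ T), f ⟨x, hT.le hx⟩ = u * x := fun x hx => hu ⟨x, hx⟩
  obtain ⟨y, hy, hyI⟩ := SetLike.exists_of_lt
    (lt_of_le_of_ne (leftAnn_anti hT.le) (hE.leftAnn_ne hN hP hT).symm)
  obtain ⟨e, he, s, hs, hsT, hse⟩ := hE.exists_mem_notMem_mul_eq hT.lt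
  have hmem : ∀ x, s * x ∈ I := fun x => by
    rw [← op_smul_eq_mul]; exact I.smul_mem _ hs
  have hsmul : ∀ x, f ⟨s, hs⟩ * x = f ⟨s * x, hmem x⟩ := fun x => by
    rw [← op_smul_eq_mul, ← map_smul]; rfl
  obtain ⟨w, hw⟩ := hE.exists_mul_of_covBy hN hP hT (v := f ⟨s, hs⟩ - u * s) he hs hse
    (hT.mul_ne_zero_of_leftAnn hs hsT hy hyI)
    (fun x hx => by rw [sub_mul, hsmul, hu' _ hx, mul_assoc, sub_self])
  refine ⟨u + w * y, fun x => ?_⟩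
  obtain ⟨a, ha⟩ := hT.exists_sub_smul_mem hs hsT x.2
  have hx : f x = f ⟨_, hT.le ha⟩ + f ⟨s, hs⟩ * a.unop := by
    rw [hsmul, ← map_add]; congr 1; ext; simp
  have hy0 := hy _ ha
  rw [hx, hu' _ ha, sub_eq_iff_eq_add.1 hw.symm]
  rw [mul_sub, sub_eq_zero] at hy0
  rw [add_mul u, mul_assoc w y (x : R), hy0, MulOpposite.smul_eq_mul_unop]
  noncomm_ring

theorem isQuasiFrobenius_of_uniformFrame {R : Type*} [Ring R]
    (hN : IsRightNoetherianRing R) (hP : LeftPInjective R) {E : Finset R}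
    (hE : IsUniformFrame E) : IsQuasiFrobenius R where
  left_artinian := hE.isArtinianRing hN hP
  right_artinian := hE.isArtinian_op hN hP
  left_injective := Module.Baer.injective fun I f => by
    obtain ⟨u, hu⟩ := hE.exists_eq_mul_right hN hP I f
    exact ⟨LinearMap.toSpanSingleton R R u, fun x hx => (hu ⟨x, hx⟩).symm⟩
  right_injective := Module.Baer.injective fun I f => by
    let T : Submodule Rᵐᵒᵖ R :=
      { carrier := {x | MulOpposite.op x ∈ I}
        add_mem' := fun ha hb => I.add_mem ha hb
        zero_mem' := I.zero_mem
        smul_mem' := fun c x hx => I.mul_mem_left c hx }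
    let g : T →ₗ[Rᵐᵒᵖ] R :=
      { toFun := fun x => f ⟨MulOpposite.op x, x.2⟩
        map_add' := fun x y => f.map_add ⟨MulOpposite.op x, x.2⟩ ⟨MulOpposite.op y, y.2⟩
        map_smul' := fun c x => f.map_smul c ⟨MulOpposite.op x, x.2⟩ }
    obtain ⟨u, hu⟩ := hE.exists_eq_mul_left hN hP T g
    exact ⟨LinearMap.toSpanSingleton Rᵐᵒᵖ R u, fun x hx => (hu ⟨x.unop, hx⟩).symm⟩

/-! ### Quasi-Frobenius rings satisfy the three conditions -/

theorem IsQuasiFrobenius.isRightNoetherianRing {R : Type*} [Ring R] (h : IsQuasiFrobenius R) :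
    IsRightNoetherianRing R := by
  have := h.right_artinian
  let φ : Rᵐᵒᵖ →ₗ[Rᵐᵒᵖ] R := LinearMap.toSpanSingleton Rᵐᵒᵖ R 1
  have hφ : ∀ a, φ a = a.unop := fun a => by
    rw [LinearMap.toSpanSingleton_apply, MulOpposite.smul_eq_mul_unop, one_mul]
  have : IsArtinianRing Rᵐᵒᵖ := isArtinian_of_injective φ fun a b hab => by
    rw [hφ, hφ] at hab; exact MulOpposite.unop_injective hab
  exact isNoetherian_of_surjective φ
    (LinearMap.range_eq_top.2 fun a => ⟨MulOpposite.op a, hφ _⟩)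

theorem isLeftNInjective_of_injective {R : Type*} [Ring R] (h : Module.Injective R R) (n : ℕ) :
    IsLeftNInjective n R := by
  rintro I - f
  obtain ⟨g, hg⟩ := h.out I.subtype I.injective_subtype f
  exact ⟨g, hg⟩

/-- Extending the projection `C ⊕ S → C` gives `y` acting as `1` on `C` and `0` on `S`. It is
idempotent modulo a nilpotent, and a polynomial in `y` is an idempotent acting in the same way;
maximality of `C` finishes. -/
theorem IsComplementTo.exists_idempotent {R : Type*} [Ring R] [IsNoetherianRing R]
    (h : Module.Injective R R) {C S : Ideal R} (hC : IsComplementTo C S) :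
    ∃ e, IsIdempotentElem e ∧ C = Ideal.span {e} := by
  have hdisj : ∀ x ∈ C, x ∈ S → x = 0 := fun x hx hx' =>
    (Submodule.mem_bot R).1 (hC.1 ▸ (⟨hx, hx'⟩ : x ∈ C ⊓ S))
  let i : (C × S) →ₗ[R] R := LinearMap.coprod C.subtype S.subtype
  have hi : ∀ c : C, ∀ s : S, i (c, s) = c + s := fun c s => by simp [i]
  obtain ⟨g, hg⟩ := h.out i (by
    rw [injective_iff_map_eq_zero]
    rintro ⟨c, s⟩ h0
    rw [hi] at h0
    have hc := hdisj c c.2 (by rw [eq_neg_of_add_eq_zero_left h0]; exact S.neg_mem s.2)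
    rw [hc, zero_add] at h0
    exact Prod.ext (Subtype.ext hc) (Subtype.ext h0)) (C.subtype.comp (LinearMap.fst R C S))
  have hgy : ∀ x, g x = x * g 1 := fun x => by
    rw [← smul_eq_mul, ← map_smul, smul_eq_mul, mul_one]
  set y := g 1
  have hCy : ∀ c ∈ C, c * y = c := fun c hc => by
    have := hg (⟨c, hc⟩, 0)
    rw [hi, hgy] at this
    simpa using this
  have hSy : ∀ s ∈ S, s * y = 0 := fun s hs => by
    have := hg (0, ⟨s, hs⟩)
    rw [hi, hgy] at this
    simpa using this
  have hess : ∀ t, t ≠ 0 → ∃ r, r * t ≠ 0 ∧ r * t ∈ C ⊔ S := by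
    intro t ht
    by_contra hcon
    push Not at hcon
    have hle : C ⊔ Ideal.span {t} ≤ C := hC.2 (by
      change (C ⊔ Ideal.span {t}) ⊓ S = ⊥
      rw [eq_bot_iff]
      rintro s ⟨hs, hsS⟩
      obtain ⟨c, hc, w, hw, rfl⟩ := Submodule.mem_sup.1 hs
      obtain ⟨r, rfl⟩ := Ideal.mem_span_singleton'.1 hw
      have hrt : r * t = 0 := by
        by_contra hne
        refine hcon r hne ?_
        have := Submodule.sub_mem _ (Submodule.mem_sup_right hsS : _ ∈ C ⊔ S)
          (Submodule.mem_sup_left hc)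
        rwa [add_sub_cancel_left] at this
      rw [hrt, add_zero] at hsS ⊢
      exact hdisj c hc hsS) le_sup_left
    exact hcon 1 (by rwa [one_mul]) (by
      rw [one_mul]
      exact Submodule.mem_sup_left (hle (Submodule.mem_sup_right (Ideal.mem_span_singleton_self t))))
  have hkill : ∀ x ∈ C ⊔ S, x * (y - y ^ 2) = 0 := by
    intro x hx
    obtain ⟨c, hc, s, hs, rfl⟩ := Submodule.mem_sup.1 hx
    rw [pow_two, mul_sub, ← mul_assoc, add_mul, hCy c hc, hSy s hs, add_zero, hCy c hc, sub_self]
  -- The left annihilators of the powers of `y - y²` stabilize, while a nonzero power would have a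
  -- nonzero left multiple in the essential ideal `C ⊔ S`, which `y - y²` kills.
  have hnil : ∃ n, (y - y ^ 2) ^ n = 0 := by
    set a := y - y ^ 2
    obtain ⟨_, ⟨n, rfl⟩, hm⟩ := set_has_maximal_iff_noetherian.2 ‹IsNoetherianRing R›
      {I : Ideal R | ∃ n : ℕ, I = leftAnn {a ^ n}} ⟨_, 0, rfl⟩
    refine ⟨n, ?_⟩
    by_contra hne
    obtain ⟨r, hr, hrm⟩ := hess _ hne
    refine hm _ ⟨n + 1, rfl⟩ (lt_of_le_of_ne (fun x hx => ?_) fun heq => hr ?_)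
    · rw [mem_leftAnn] at hx ⊢
      rintro _ rfl
      rw [pow_succ, ← mul_assoc, hx _ rfl, zero_mul]
    · have : r ∈ leftAnn {a ^ (n + 1)} := by
        rintro _ rfl
        rw [pow_succ, ← mul_assoc]
        exact hkill _ hrm
      rw [← heq] at this
      exact this _ rfl
  obtain ⟨n, hn⟩ := hnil
  -- Exponent zero means the ring is trivial; elsewhere a positive exponent is needed for `e` to act
  -- as `y` does.
  rcases n with _ | n
  · have hsub : ∀ x : R, x = 0 := fun x => by
      rw [pow_zero] at hn
      rw [← mul_one x, hn, mul_zero]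
    refine ⟨0, IsIdempotentElem.zero, ?_⟩
    ext x
    rw [hsub x]
    simp
  have hidem := isIdempotentElem_one_sub_one_sub_pow_pow y (n + 1) hn
  set e := 1 - (1 - y ^ (n + 1)) ^ (n + 1)
  have hpow : ∀ (m : ℕ) (x z : R), x * z = x → x * z ^ m = x := by
    intro m x z hxz
    induction m with
    | zero => simp
    | succ m ih => rw [pow_succ, ← mul_assoc, ih, hxz]
  have hCe : ∀ c ∈ C, c * e = c := fun c hc => by
    have : c * (1 - y ^ (n + 1)) = 0 := by
      rw [mul_sub, mul_one, hpow _ _ _ (hCy c hc), sub_self]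
    rw [mul_sub, mul_one, pow_succ' (1 - y ^ (n + 1)), ← mul_assoc, this, zero_mul, sub_zero]
  have hSe : ∀ s ∈ S, s * e = 0 := fun s hs => by
    have : s * (1 - y ^ (n + 1)) = s := by
      rw [mul_sub, mul_one, pow_succ', ← mul_assoc, hSy s hs, zero_mul, sub_zero]
    rw [mul_sub, mul_one, hpow _ _ _ this, sub_self]
  have hCle : C ≤ Ideal.span {e} := fun c hc => Ideal.mem_span_singleton'.2 ⟨c, hCe c hc⟩
  refine ⟨e, hidem, le_antisymm hCle (hC.2 ?_ hCle)⟩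
  change Ideal.span {e} ⊓ S = ⊥
  rw [eq_bot_iff]
  rintro s ⟨hs, hsS⟩
  obtain ⟨x, rfl⟩ := Ideal.mem_span_singleton'.1 hs
  have := hSe _ hsS
  rwa [mul_assoc, hidem.eq] at this

theorem not_isSmallLeftIdeal_span_idempotent {R : Type*} [Ring R] {e : R}
    (he : IsIdempotentElem e) (h : Ideal.span {e} ≠ ⊥) : ¬ IsSmallLeftIdeal (Ideal.span {e}) := by
  intro hs
  have htop := hs (Ideal.span {1 - e}) (by
    rw [Ideal.eq_top_iff_one]
    have := Submodule.add_mem_sup (Ideal.mem_span_singleton_self (1 - e))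
      (Ideal.mem_span_singleton_self e)
    rwa [sub_add_cancel] at this)
  obtain ⟨x, hx⟩ := Ideal.mem_span_singleton'.1 ((Ideal.eq_top_iff_one _).1 htop)
  apply h
  have : e = 0 := by
    rw [← one_mul e, ← hx, mul_assoc, sub_mul, one_mul, he.eq, sub_self, mul_zero]
  rw [this]
  simp

theorem theorem2p4 (R : Type*) [Ring R] :
    IsQuasiFrobenius R ↔
      IsRightNoetherianRing R ∧ IsLeftNInjective 2 R ∧
        ∀ I : Ideal R, I ≠ ⊥ → IsComplementSubmodule I → ¬ IsSmallLeftIdeal I := by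
  constructor
  · intro h
    refine ⟨h.isRightNoetherianRing, isLeftNInjective_of_injective h.left_injective 2, ?_⟩
    rintro I hI ⟨S, hS⟩
    have : IsArtinianRing R := h.left_artinian
    obtain ⟨e, he, rfl⟩ := hS.exists_idempotent h.left_injective
    exact not_isSmallLeftIdeal_span_idempotent he hI
  · rintro ⟨hN, h2, hC⟩
    have hP := leftPInjective_of_two h2
    obtain ⟨E, hE⟩ := exists_uniformFrame
      (span_uniformIdempotents hN hP (separatesIndependent_of_two h2) hC)
    exact isQuasiFrobenius_of_uniformFrame hN hP hE
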